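/- Let $\Bbbk$ be a field. For a finite linearly independent set $W$ of forms of degree two in $\Bbbk[x_1,\dots,x_n]$, let $\Bbbk[W]$ be the subalgebra generated by $W$, with Hilbert function $\operatorname{HF}(\Bbbk[W],i)=\dim_\Bbbk \operatorname{span}(W^i)$, where $W^i$ is the set of all products of $i$ elements of $W$. A set $M$ of monomials of degree two is strongly stable if $m\in M$, $x_a\mid m$ and $b<a$ imply $(x_b/x_a)\,m\in M$. For a positive integer $u\le\binom{n+1}{2}$, let $\operatorname{RevLex}(u)$ be the set of the $u$ greatest monomials of degree two in $x_1,\dots,x_n$ for the order in which, for $a\le b$ and $c\le d$, $x_ax_b>x_cx_d$ if $b<d$, or if $b=d$ and $a<c$. **Theorem.** Let $n\ge 80$, $1\le r\le 50$ and $u_n=\binom n2+r$. Then $\Bbbk[\operatorname{RevLex}(u_n)]$ has (asymptotically) minimal Hilbert function among the subalgebras of $\Bbbk[x_1,\dots,x_n]$ generated by $u_n$ linearly independent forms of degree two. That is, there is a number $N$ such that for every $i>N$ the value $\operatorname{HF}(\Bbbk[\operatorname{RevLex}(u_n)],i)$ is both the minimum of $\operatorname{HF}(\Bbbk[M],i)$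 over all strongly stable sets $M$ of $u_n$ monomials of degree two in $x_1,\dots,x_n$, and the minimum of $\operatorname{HF}(\Bbbk[W],i)$ over all linearly independent sets $W$ of $u_n$ forms of degree two in $\Bbbk[x_1,\dots,x_n]$. -/

import Mathlib

open scoped Pointwise

namespace MinimalHF

noncomputable section

/-- The Hilbert function of the algebra `𝕜[W]` generated by a set `W` of forms of one common
degree: the `𝕜`-dimension of the span of the set `W ^ i` of all products of `i` elements of `W`. -/
def hilbertFn (𝕜 : Type*) [Field 𝕜] {n : ℕ} (W : Set (MvPolynomial (Fin n) 𝕜)) (i : ℕ) : ℕ :=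
  Module.finrank 𝕜 (Submodule.span 𝕜 (W ^ i))

/-- The monomials with exponent vectors in `M`, as polynomials with coefficients in `𝕜`. -/
def monomialForms (𝕜 : Type*) [Field 𝕜] {n : ℕ} (M : Finset (Fin n →₀ ℕ)) :
    Set (MvPolynomial (Fin n) 𝕜) :=
  (fun m => MvPolynomial.monomial m (1 : 𝕜)) '' (M : Set (Fin n →₀ ℕ))

/-- A set `M` of monomials of degree `d` in `n` variables (given by exponent vectors) is strongly
stable if `m ∈ M`, `x_i ∣ m` and `j < i` imply `(x_j / x_i) m ∈ M`. -/
def IsStronglyStable {n : ℕ} (d : ℕ) (M : Finset (Fin n →₀ ℕ)) : Prop :=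
  (∀ m ∈ M, m.degree = d) ∧
    ∀ m ∈ M, ∀ i j : Fin n, m i ≠ 0 → j < i →
      m - Finsupp.single i 1 + Finsupp.single j 1 ∈ M

/-- The values at `i` of the Hilbert functions of the algebras generated by strongly stable sets
of `u` monomials of degree `d` in `n` variables. -/
def stronglyStableValues (𝕜 : Type*) [Field 𝕜] (n d u i : ℕ) : Set ℕ :=
  {h | ∃ M : Finset (Fin n →₀ ℕ), IsStronglyStable d M ∧ M.card = u ∧
    h = hilbertFn 𝕜 (monomialForms 𝕜 M) i}

/-- The values at `i` of the Hilbert functions of the algebras generated by `u` linearly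
independent forms of degree `d` in `n` variables. -/
def formValues (𝕜 : Type*) [Field 𝕜] (n d u i : ℕ) : Set ℕ :=
  {h | ∃ W : Finset (MvPolynomial (Fin n) 𝕜), (∀ f ∈ W, f.IsHomogeneous d) ∧
    LinearIndepOn 𝕜 id (W : Set (MvPolynomial (Fin n) 𝕜)) ∧ W.card = u ∧
    h = hilbertFn 𝕜 (W : Set (MvPolynomial (Fin n) 𝕜)) i}

/-- The reverse lexicographic order on monomials of degree two, where a pair `p = (i, j)` with
`i ≤ j` stands for `x_i x_j`: `x_i x_j > x_k x_l` if `j < l`, or `j = l` and `i < k`. -/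
def RevLexGT {n : ℕ} (p q : Fin n × Fin n) : Prop :=
  p.2 < q.2 ∨ (p.2 = q.2 ∧ p.1 < q.1)

open Classical in
/-- The (pairs of indices of the) `u` greatest monomials of degree two in `n` variables in the
reverse lexicographic order: those with fewer than `u` monomials above them. -/
def revLexPairs (n u : ℕ) : Finset (Fin n × Fin n) :=
  {p | p.1 ≤ p.2 ∧
    (Finset.univ.filter fun q : Fin n × Fin n => q.1 ≤ q.2 ∧ RevLexGT q p).card < u}

open Classical in
/-- `RevLex(u)` inside the monomials in `n` variables, as a set of exponent vectors. -/
def revLex (n u : ℕ) : Finset (Fin n →₀ ℕ) :=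
  (revLexPairs n u).image fun p => Finsupp.single p.1 1 + Finsupp.single p.2 1

end

end MinimalHF

/-! Everything reduces to sizes of iterated sumsets of exponent vectors. Leading monomials of
products are products of leading monomials, so replacing a space of forms by its leading monomials
cannot enlarge any power (`exists_monomials_card_iterSum_le`). Compressing a set of monomials along
all directions from `x_a` to `x_b`, `b < a`, makes it strongly stable, and Cauchy-Davenport in each
fiber shows that sumsets do not grow (`exists_stronglyStable_card_iterSum_le`). What remains is to
compare RevLex with a strongly stable `M`.

Let `s` be the number of squares in `M` and `p = n - s`. Greedy pairing
(`IsStronglyStable.mem_iterSum`) shows that a monomial of degree `2i` outside the `i`-th power of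
`M` has, for some `j ≥ s`, more total exponent on the variables from `x_j` on than on the neighbours
of `x_j`. So at most `p` sets of the form `exceeding` cover the missing monomials. In high degree
the exponents behave, up to scale, like independent exponential variables; a sum of `k` of them
beats a sum of `g` others with probability `binomTail k g`, as two competing Poisson processes show.
`card_exceeding_le` is the rigorous form, valid up to a shift of degree. For RevLex the last
variable competes with the first `r`, and the missing proportion is asymptotically at least
`binomTail 1 r = 2⁻ʳ`.

If `p = 0` nothing is missing from `M`; if `p = 1` its missing monomials lie in the corresponding
RevLex set. If `p ≥ 2`, the cardinality of `M` forces so many neighbours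
(`IsStronglyStable.le_mul_nbrCount`) that the tails add up to at most `3/4 · 2⁻ʳ`
(`sum_binomTail_le`). The factor `3/4` absorbs the shift of degree once `i` is large, uniformly in
`M`. The bound on `n` enters the comparison only through `r + 30 ≤ n`. -/

namespace MinimalHF

/-! ### Hilbert functions, sumsets and leading monomials -/

section Algebra

/-- The `i`-fold sumset of a finite set. -/
def iterSum {A : Type*} [AddCommMonoid A] [DecidableEq A] (M : Finset A) : ℕ → Finset A
  | 0 => {0}
  | i + 1 => iterSum M i + M

variable {𝕜 : Type*} [Field 𝕜] {n : ℕ}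

theorem monomialForms_pow (M : Finset (Fin n →₀ ℕ)) (i : ℕ) :
    monomialForms 𝕜 M ^ i =
      (fun m => MvPolynomial.monomial m (1 : 𝕜)) '' (iterSum M i : Set (Fin n →₀ ℕ)) := by
  induction i with
  | zero => simp [iterSum]; rfl
  | succ i ih =>
    rw [pow_succ, ih]
    ext f
    simp only [iterSum, monomialForms, Set.mem_mul, Set.mem_image, Finset.mem_coe,
      Finset.mem_add]
    constructor
    · rintro ⟨_, ⟨a, ha, rfl⟩, _, ⟨b, hb, rfl⟩, rfl⟩
      exact ⟨a + b, ⟨a, ha, b, hb, rfl⟩, by simp [MvPolynomial.monomial_mul]⟩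
    · rintro ⟨_, ⟨a, ha, b, hb, rfl⟩, rfl⟩
      exact ⟨_, ⟨a, ha, rfl⟩, _, ⟨b, hb, rfl⟩, by simp [MvPolynomial.monomial_mul]⟩

theorem linearIndependent_monomials :
    LinearIndependent 𝕜 (fun m : Fin n →₀ ℕ => MvPolynomial.monomial m (1 : 𝕜)) := by
  have h := (MvPolynomial.basisMonomials (Fin n) 𝕜).linearIndependent
  rwa [MvPolynomial.coe_basisMonomials] at h

theorem hilbertFn_monomialForms (M : Finset (Fin n →₀ ℕ)) (i : ℕ) :
    hilbertFn 𝕜 (monomialForms 𝕜 M) i = (iterSum M i).card := by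
  classical
  rw [hilbertFn, monomialForms_pow, ← Finset.coe_image, finrank_span_finset_eq_card,
    Finset.card_image_of_injective _ linearIndependent_monomials.injective]
  rw [Finset.coe_image]
  exact (linearIndependent_monomials (𝕜 := 𝕜) (n := n)).linearIndepOn_id.mono
    (Set.image_subset_range _ _)

/-- A family of nonzero polynomials with distinct leading monomials is linearly independent. -/
theorem linearIndependent_of_degree_injective {ι : Type*} (o : MonomialOrder (Fin n))
    (f : ι → MvPolynomial (Fin n) 𝕜) (hf : ∀ i, f i ≠ 0)
    (hinj : Function.Injective fun i => o.degree (f i)) : LinearIndependent 𝕜 f := by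
  classical
  rw [linearIndependent_iff']
  intro s g hg
  by_contra! hne
  obtain ⟨i, his, hi⟩ := hne
  obtain ⟨k, hk, hmax⟩ := (s.filter fun j => g j ≠ 0).exists_max_image
    (fun j => o.toSyn (o.degree (f j))) ⟨i, by simp [his, hi]⟩
  rw [Finset.mem_filter] at hk
  have h0 := congrArg (MvPolynomial.coeff (o.degree (f k))) hg
  rw [MvPolynomial.coeff_sum, Finset.sum_eq_single k] at h0
  · simp only [MvPolynomial.coeff_smul, smul_eq_mul, MvPolynomial.coeff_zero, mul_eq_zero] at h0
    exact h0.elim hk.2 (MonomialOrder.coeff_degree_ne_zero_iff.2 (hf k))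
  · intro j hj hjk
    by_cases hgj : g j = 0
    · simp [hgj]
    · have hle := hmax j (by simp [hj, hgj])
      rw [MvPolynomial.coeff_smul, MonomialOrder.coeff_eq_zero_of_lt, smul_zero]
      exact lt_of_le_of_ne hle fun h => hjk (hinj (o.toSyn.injective h))
  · exact fun h => absurd hk.1 h

/-- The leading monomials of the nonzero elements of a subspace. -/
def leadingMonomials (o : MonomialOrder (Fin n)) (V : Submodule 𝕜 (MvPolynomial (Fin n) 𝕜)) :
    Set (Fin n →₀ ℕ) :=
  {m | ∃ f ∈ V, f ≠ 0 ∧ o.degree f = m}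

theorem card_le_finrank_of_subset_leadingMonomials (o : MonomialOrder (Fin n))
    (V : Submodule 𝕜 (MvPolynomial (Fin n) 𝕜)) [FiniteDimensional 𝕜 V]
    (S : Finset (Fin n →₀ ℕ)) (hS : (S : Set (Fin n →₀ ℕ)) ⊆ leadingMonomials o V) :
    S.card ≤ Module.finrank 𝕜 V := by
  choose f hfV hf0 hfd using fun m : S => hS m.2
  have hli : LinearIndependent 𝕜 (fun m : S => (⟨f m, hfV m⟩ : V)) := by
    refine LinearIndependent.of_comp V.subtype ?_
    refine linearIndependent_of_degree_injective o _ (fun m => hf0 m) fun a b hab => ?_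
    exact Subtype.ext ((hfd a).symm.trans (Eq.trans hab (hfd b)))
  simpa using hli.fintype_card_le_finrank

/-- An element of `V` whose coefficients on `S` all vanish has no leading monomial, hence is zero;
so the coefficients on `S` embed `V`. -/
theorem finrank_le_card_of_leadingMonomials_subset (o : MonomialOrder (Fin n))
    (V : Submodule 𝕜 (MvPolynomial (Fin n) 𝕜))
    (S : Finset (Fin n →₀ ℕ)) (hS : leadingMonomials o V ⊆ S) :
    Module.finrank 𝕜 V ≤ S.card := by
  let φ : V →ₗ[𝕜] (S → 𝕜) :=
    { toFun := fun f m => MvPolynomial.coeff m.1 f.1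
      map_add' := fun f g => by ext; simp
      map_smul' := fun c f => by ext; simp }
  have hφ : Function.Injective φ := by
    rw [← LinearMap.ker_eq_bot, LinearMap.ker_eq_bot']
    intro f hf
    by_contra hne
    have hne' : f.1 ≠ 0 := fun h => hne (Subtype.ext h)
    exact MonomialOrder.coeff_degree_ne_zero_iff.2 hne'
      (congrFun hf ⟨o.degree f.1, hS ⟨f.1, f.2, hne', rfl⟩⟩)
  simpa using LinearMap.finrank_le_finrank_of_injective hφ

theorem iterSum_subset_leadingMonomials (o : MonomialOrder (Fin n))
    (V : Submodule 𝕜 (MvPolynomial (Fin n) 𝕜)) (M : Finset (Fin n →₀ ℕ))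
    (hM : (M : Set (Fin n →₀ ℕ)) ⊆ leadingMonomials o V) (i : ℕ) :
    (iterSum M i : Set (Fin n →₀ ℕ)) ⊆ leadingMonomials o (V ^ i) := by
  induction i with
  | zero =>
    intro m hm
    have hm0 : m = 0 := by simpa [iterSum] using hm
    exact ⟨1, by rw [pow_zero]; exact Submodule.one_le.1 le_rfl, one_ne_zero, by simp [hm0]⟩
  | succ i ih =>
    intro m hm
    rw [Finset.mem_coe, iterSum, Finset.mem_add] at hm
    obtain ⟨a, ha, b, hb, rfl⟩ := hm
    obtain ⟨f, hf, hf0, rfl⟩ := ih ha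
    obtain ⟨g, hg, hg0, rfl⟩ := hM hb
    exact ⟨f * g, by rw [pow_succ]; exact Submodule.mul_mem_mul hf hg, mul_ne_zero hf0 hg0,
      MonomialOrder.degree_mul hf0 hg0⟩

/-- Passing to leading monomials does not increase the Hilbert function. -/
theorem exists_monomials_card_iterSum_le (d : ℕ) (W : Finset (MvPolynomial (Fin n) 𝕜))
    (hW : ∀ f ∈ W, f.IsHomogeneous d)
    (hli : LinearIndepOn 𝕜 id (W : Set (MvPolynomial (Fin n) 𝕜))) :
    ∃ M : Finset (Fin n →₀ ℕ), (∀ m ∈ M, m.degree = d) ∧ M.card = W.card ∧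
      ∀ i, (iterSum M i).card ≤ hilbertFn 𝕜 (W : Set (MvPolynomial (Fin n) 𝕜)) i := by
  classical
  -- Any monomial order would do.
  let o : MonomialOrder (Fin n) := MonomialOrder.lex
  set V := Submodule.span 𝕜 (W : Set (MvPolynomial (Fin n) 𝕜)) with hV
  have hdeg : ∀ m ∈ leadingMonomials o V, m.degree = d := by
    rintro m ⟨f, hf, hf0, rfl⟩
    have hVle : V ≤ MvPolynomial.homogeneousSubmodule (Fin n) 𝕜 d :=
      Submodule.span_le.2 fun f hf => hW f hf
    by_contra hne
    exact MonomialOrder.coeff_degree_ne_zero_iff.2 hf0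
      (MvPolynomial.IsHomogeneous.coeff_eq_zero (hVle hf) hne)
  have hfin : (leadingMonomials o V).Finite := by
    refine Set.Finite.subset ((Finset.univ : Finset (Fin n)).finsuppAntidiag d).finite_toSet ?_
    intro m hm
    have := hdeg m hm
    simpa [Finset.mem_finsuppAntidiag, Finsupp.degree_eq_sum] using this
  have hcard : W.card ≤ hfin.toFinset.card := by
    rw [← finrank_span_finset_eq_card hli]
    exact finrank_le_card_of_leadingMonomials_subset o V _ (by simp)
  obtain ⟨M, hM, hMc⟩ := Finset.exists_subset_card_eq hcard
  have hM' : (M : Set (Fin n →₀ ℕ)) ⊆ leadingMonomials o V := fun m hm => by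
    simpa using hM hm
  refine ⟨M, fun m hm => hdeg m (hM' hm), hMc, fun i => ?_⟩
  have : FiniteDimensional 𝕜 (Submodule.span 𝕜 ((W : Set (MvPolynomial (Fin n) 𝕜)) ^ i)) :=
    FiniteDimensional.span_of_finite 𝕜 (by
      rw [← Finset.coe_pow]; exact Finset.finite_toSet _)
  refine card_le_finrank_of_subset_leadingMonomials o _ _ ?_
  rw [← Submodule.span_pow]
  exact iterSum_subset_leadingMonomials o V M hM' i

end Algebra

/-! ### Compression to strongly stable sets -/

section Compression

variable {n : ℕ} {a b : Fin n}

/-- The elements of `A` that agree with `x` up to moving exponents between positions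
`a` and `b`. -/
def fiber (a b : Fin n) (A : Finset (Fin n →₀ ℕ)) (x : Fin n →₀ ℕ) : Finset (Fin n →₀ ℕ) :=
  A.filter fun y => y a + y b = x a + x b ∧ ∀ c, c ≠ a → c ≠ b → y c = x c

theorem mem_fiber {A : Finset (Fin n →₀ ℕ)} {x y : Fin n →₀ ℕ} :
    y ∈ fiber a b A x ↔ y ∈ A ∧ y a + y b = x a + x b ∧ ∀ c, c ≠ a → c ≠ b → y c = x c :=
  Finset.mem_filter

theorem fiber_congr {A : Finset (Fin n →₀ ℕ)} {x y : Fin n →₀ ℕ} (h : x a + x b = y a + y b)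
    (h' : ∀ c, c ≠ a → c ≠ b → x c = y c) : fiber a b A x = fiber a b A y := by
  ext z
  simp only [mem_fiber, h]
  refine and_congr_right fun _ => and_congr_right fun _ => ?_
  exact forall_congr' fun c => forall_congr' fun h1 => forall_congr' fun h2 => by rw [h' c h1 h2]

theorem eq_of_fiber {A : Finset (Fin n →₀ ℕ)} {x y z : Fin n →₀ ℕ} (hy : y ∈ fiber a b A x)
    (hz : z ∈ fiber a b A x) (h : y a = z a) : y = z := by
  rw [mem_fiber] at hy hz
  ext c
  by_cases hca : c = a
  · rw [hca, h]
  by_cases hcb : c = b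
  · subst hcb; omega
  rw [hy.2.2 c hca hcb, hz.2.2 c hca hcb]

/-- The rank of `y` in its fiber, with respect to the exponent at `a`. -/
def fiberRank (a b : Fin n) (A : Finset (Fin n →₀ ℕ)) (y : Fin n →₀ ℕ) : ℕ :=
  ((fiber a b A y).filter fun z => z a < y a).card

/-- A member of a fiber is determined by its exponent at `a`. In particular ranks never exceed
exponents, so compression only moves exponents from `a` to `b`. -/
theorem card_filter_fiber_lt_le (A : Finset (Fin n →₀ ℕ)) (y : Fin n →₀ ℕ) (t : ℕ) :
    ((fiber a b A y).filter fun z => z a < t).card ≤ t := by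
  rw [← Finset.card_range t]
  refine Finset.card_le_card_of_injOn (fun z => z a) (fun z hz => ?_) ?_
  · simpa using (Finset.mem_filter.1 hz).2
  · intro z hz w hw h
    exact eq_of_fiber (Finset.mem_filter.1 hz).1 (Finset.mem_filter.1 hw).1 h

theorem fiberRank_le (A : Finset (Fin n →₀ ℕ)) (y : Fin n →₀ ℕ) : fiberRank a b A y ≤ y a :=
  card_filter_fiber_lt_le A y _

theorem self_mem_fiber {A : Finset (Fin n →₀ ℕ)} {y : Fin n →₀ ℕ} (hy : y ∈ A) :
    y ∈ fiber a b A y := mem_fiber.2 ⟨hy, rfl, fun _ _ _ => rfl⟩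

theorem fiberRank_lt_card {A : Finset (Fin n →₀ ℕ)} {y : Fin n →₀ ℕ} (hy : y ∈ A) :
    fiberRank a b A y < (fiber a b A y).card := by
  refine Finset.card_lt_card ⟨Finset.filter_subset _ _, fun h => ?_⟩
  exact lt_irrefl _ (Finset.mem_filter.1 (h (self_mem_fiber hy))).2

theorem fiberRank_strictMono {A : Finset (Fin n →₀ ℕ)} {x y z : Fin n →₀ ℕ}
    (hy : y ∈ fiber a b A x) (hz : z ∈ fiber a b A x) (h : y a < z a) :
    fiberRank a b A y < fiberRank a b A z := by
  rw [fiberRank, fiberRank, fiber_congr (mem_fiber.1 hy).2.1 (mem_fiber.1 hy).2.2,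
    fiber_congr (mem_fiber.1 hz).2.1 (mem_fiber.1 hz).2.2]
  refine Finset.card_lt_card ⟨fun w hw => ?_, fun hs => ?_⟩
  · rw [Finset.mem_filter] at hw ⊢
    exact ⟨hw.1, hw.2.trans h⟩
  · exact lt_irrefl _ (Finset.mem_filter.1 (hs (Finset.mem_filter.2 ⟨hy, h⟩))).2

theorem exists_fiberRank_eq {A : Finset (Fin n →₀ ℕ)} {x : Fin n →₀ ℕ} {t : ℕ}
    (ht : t < (fiber a b A x).card) : ∃ y ∈ fiber a b A x, fiberRank a b A y = t := by
  have hinj : Set.InjOn (fiberRank a b A) (fiber a b A x : Set (Fin n →₀ ℕ)) := by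
    intro y hy z hz h
    rcases lt_trichotomy (y a) (z a) with hlt | heq | hlt
    · exact absurd h (fiberRank_strictMono hy hz hlt).ne
    · exact eq_of_fiber hy hz heq
    · exact absurd h.symm (fiberRank_strictMono hz hy hlt).ne
  have him : (fiber a b A x).image (fiberRank a b A) = Finset.range (fiber a b A x).card := by
    refine Finset.eq_of_subset_of_card_le (fun r hr => ?_) ?_
    · obtain ⟨y, hy, rfl⟩ := Finset.mem_image.1 hr
      have h := mem_fiber.1 hy
      rw [Finset.mem_range, ← fiber_congr h.2.1 h.2.2]
      exact fiberRank_lt_card h.1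
    · rw [Finset.card_image_of_injOn hinj, Finset.card_range]
  simpa using him.ge (Finset.mem_range.2 ht)

/-- Move the exponent at `a` of `y` down to its rank in the fiber, compensating at `b`. -/
noncomputable def compressFun (a b : Fin n) (A : Finset (Fin n →₀ ℕ)) (y : Fin n →₀ ℕ) :
    Fin n →₀ ℕ :=
  (y.update a (fiberRank a b A y)).update b (y a + y b - fiberRank a b A y)

/-- The compression of `A` along the direction from `a` to `b`. -/
noncomputable def compress (a b : Fin n) (A : Finset (Fin n →₀ ℕ)) : Finset (Fin n →₀ ℕ) :=
  A.image (compressFun a b A)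

theorem compressFun_left (hab : a ≠ b) (A : Finset (Fin n →₀ ℕ)) (y : Fin n →₀ ℕ) :
    compressFun a b A y a = fiberRank a b A y := by
  simp [compressFun, hab]

theorem compressFun_right (A : Finset (Fin n →₀ ℕ)) (y : Fin n →₀ ℕ) :
    compressFun a b A y b = y a + y b - fiberRank a b A y := by
  simp [compressFun]

theorem compressFun_of_ne (A : Finset (Fin n →₀ ℕ)) (y : Fin n →₀ ℕ) {c : Fin n} (ha : c ≠ a)
    (hb : c ≠ b) : compressFun a b A y c = y c := by
  simp [compressFun, ha, hb]

theorem compressFun_add (hab : a ≠ b) (A : Finset (Fin n →₀ ℕ)) (y : Fin n →₀ ℕ) :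
    compressFun a b A y a + compressFun a b A y b = y a + y b := by
  rw [compressFun_left hab, compressFun_right]
  have := fiberRank_le (a := a) (b := b) A y
  omega

/-- Compression replaces a fiber of size `t` by the vectors whose exponents at `a` are `0, …, t -
1`. -/
theorem mem_compress (hab : a ≠ b) {A : Finset (Fin n →₀ ℕ)} {x : Fin n →₀ ℕ} :
    x ∈ compress a b A ↔ x a < (fiber a b A x).card := by
  constructor
  · intro h
    obtain ⟨y, hy, rfl⟩ := Finset.mem_image.1 h
    rw [fiber_congr (compressFun_add hab A y) fun c => compressFun_of_ne A y,
      compressFun_left hab]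
    exact fiberRank_lt_card hy
  · intro h
    obtain ⟨y, hy, hr⟩ := exists_fiberRank_eq h
    rw [mem_fiber] at hy
    refine Finset.mem_image.2 ⟨y, hy.1, ?_⟩
    ext c
    by_cases hca : c = a
    · rw [hca, compressFun_left hab, hr]
    by_cases hcb : c = b
    · rw [hcb, compressFun_right, hr]; omega
    rw [compressFun_of_ne A y hca hcb, hy.2.2 c hca hcb]

theorem card_compress (hab : a ≠ b) (A : Finset (Fin n →₀ ℕ)) :
    (compress a b A).card = A.card := by
  refine Finset.card_image_of_injOn fun y hy z hz h => ?_
  have h1 : z a + z b = y a + y b := by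
    rw [← compressFun_add hab A y, ← compressFun_add hab A z, h]
  have h2 : ∀ c, c ≠ a → c ≠ b → z c = y c := fun c ha hb => by
    rw [← compressFun_of_ne A y ha hb, ← compressFun_of_ne A z ha hb, h]
  have hzf : z ∈ fiber a b A y := mem_fiber.2 ⟨hz, h1, h2⟩
  have h3 : fiberRank a b A y = fiberRank a b A z := by
    rw [← compressFun_left hab, ← compressFun_left hab, h]
  rcases lt_trichotomy (y a) (z a) with hlt | heq | hlt
  · exact absurd h3 (fiberRank_strictMono (self_mem_fiber hy) hzf hlt).ne
  · exact eq_of_fiber (self_mem_fiber hy) hzf heq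
  · exact absurd h3.symm (fiberRank_strictMono hzf (self_mem_fiber hy) hlt).ne

/-- Fibers are finite sets of integers via the exponent at `a`, and the sum of two fibers lies in
the fiber of the sum. There `|P + Q| ≥ |P| + |Q| - 1`, and initial segments attain equality. -/
theorem compress_add_subset (hab : a ≠ b) (A B : Finset (Fin n →₀ ℕ)) :
    compress a b A + compress a b B ⊆ compress a b (A + B) := by
  intro z hz
  obtain ⟨x, hx, y, hy, rfl⟩ := Finset.mem_add.1 hz
  rw [mem_compress hab] at hx hy ⊢
  have hsub : fiber a b A x + fiber a b B y ⊆ fiber a b (A + B) (x + y) := by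
    intro w hw
    obtain ⟨p, hp, q, hq, rfl⟩ := Finset.mem_add.1 hw
    rw [mem_fiber] at hp hq ⊢
    refine ⟨Finset.add_mem_add hp.1 hq.1, ?_, fun c ha hb => ?_⟩
    · simp only [Finsupp.add_apply]; omega
    · rw [Finsupp.add_apply, Finsupp.add_apply, hp.2.2 c ha hb, hq.2.2 c ha hb]
  have hinj : ∀ (C : Finset (Fin n →₀ ℕ)) (v : Fin n →₀ ℕ),
      ((fiber a b C v).image fun w => w a).card = (fiber a b C v).card := fun C v =>
    Finset.card_image_of_injOn fun p hp q hq h => eq_of_fiber hp hq h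
  have hne : ∀ {C : Finset (Fin n →₀ ℕ)} {v : Fin n →₀ ℕ}, v a < (fiber a b C v).card →
      ((fiber a b C v).image fun w => w a).Nonempty := fun h =>
    (Finset.card_pos.1 (by omega)).image _
  have hcd := cauchy_davenport_add_of_linearOrder_isCancelAdd (hne hx) (hne hy)
  have him : ((fiber a b A x).image fun w => w a) + ((fiber a b B y).image fun w => w a) ⊆
      (fiber a b (A + B) (x + y)).image fun w => w a := by
    intro t ht
    obtain ⟨_, hp', _, hq', rfl⟩ := Finset.mem_add.1 ht
    obtain ⟨p, hp, rfl⟩ := Finset.mem_image.1 hp'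
    obtain ⟨q, hq, rfl⟩ := Finset.mem_image.1 hq'
    exact Finset.mem_image.2 ⟨p + q, hsub (Finset.add_mem_add hp hq), rfl⟩
  have hle := Finset.card_le_card him
  rw [hinj] at hle
  rw [hinj, hinj] at hcd
  simp only [Finsupp.add_apply]
  omega

theorem iterSum_compress_subset (hab : a ≠ b) (A : Finset (Fin n →₀ ℕ)) (i : ℕ) :
    iterSum (compress a b A) i ⊆ compress a b (iterSum A i) := by
  induction i with
  | zero =>
    intro x hx
    have hx0 : x = 0 := by simpa [iterSum] using hx
    rw [mem_compress hab, hx0]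
    exact Finset.card_pos.2 ⟨0, self_mem_fiber (by simp [iterSum])⟩
  | succ i ih =>
    exact (Finset.add_subset_add_right ih).trans (compress_add_subset hab _ _)

theorem card_iterSum_compress_le (hab : a ≠ b) (A : Finset (Fin n →₀ ℕ)) (i : ℕ) :
    (iterSum (compress a b A) i).card ≤ (iterSum A i).card :=
  (Finset.card_le_card (iterSum_compress_subset hab A i)).trans (card_compress hab _).le

/-- The total of the indices of the variables in a monomial, with multiplicity. -/
def indexWeight (m : Fin n →₀ ℕ) : ℕ := ∑ c : Fin n, (c : ℕ) * m c

theorem sum_eq_add_sum_compl_pair (hab : a ≠ b) (f : Fin n → ℕ) :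
    ∑ c, f c = f a + f b + ∑ c ∈ Finset.univ \ {a, b}, f c := by
  rw [← Finset.sum_sdiff (Finset.subset_univ {a, b}), Finset.sum_pair hab, add_comm]

theorem degree_compressFun (hab : a ≠ b) (A : Finset (Fin n →₀ ℕ)) (y : Fin n →₀ ℕ) :
    (compressFun a b A y).degree = y.degree := by
  rw [Finsupp.degree_eq_sum, Finsupp.degree_eq_sum, sum_eq_add_sum_compl_pair hab,
    sum_eq_add_sum_compl_pair hab, compressFun_add hab]
  congr 1
  refine Finset.sum_congr rfl fun c hc => ?_
  simp only [Finset.mem_sdiff, Finset.mem_univ, Finset.mem_insert, Finset.mem_singleton,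
    true_and, not_or] at hc
  exact compressFun_of_ne A y hc.1 hc.2

theorem indexWeight_compressFun (hab : b < a) (A : Finset (Fin n →₀ ℕ)) (y : Fin n →₀ ℕ) :
    indexWeight (compressFun a b A y) + (a - b) * (y a - fiberRank a b A y) = indexWeight y := by
  have h : ∑ c ∈ Finset.univ \ {a, b}, (c : ℕ) * compressFun a b A y c =
      ∑ c ∈ Finset.univ \ {a, b}, (c : ℕ) * y c := by
    refine Finset.sum_congr rfl fun c hc => ?_
    simp only [Finset.mem_sdiff, Finset.mem_univ, Finset.mem_insert, Finset.mem_singleton,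
      true_and, not_or] at hc
    rw [compressFun_of_ne A y hc.1 hc.2]
  rw [indexWeight, indexWeight, sum_eq_add_sum_compl_pair hab.ne', sum_eq_add_sum_compl_pair hab.ne',
    h, compressFun_left hab.ne', compressFun_right]
  obtain ⟨t, ht⟩ := Nat.exists_eq_add_of_le (fiberRank_le (a := a) (b := b) A y)
  obtain ⟨e, he⟩ := Nat.exists_eq_add_of_le (Fin.lt_def.1 hab).le
  rw [ht, he, Nat.add_sub_cancel_left, Nat.add_sub_cancel_left,
    show fiberRank a b A y + t + y b - fiberRank a b A y = t + y b by omega]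
  ring

/-- A set of monomials fixed by the compression from `a` to `b` is closed under the corresponding
exchanges. -/
theorem exchange_mem_of_compress_eq (hab : a ≠ b) {A : Finset (Fin n →₀ ℕ)} {m : Fin n →₀ ℕ}
    (hfix : compress a b A = A) (hm : m ∈ A) (hma : m a ≠ 0) :
    m - Finsupp.single a 1 + Finsupp.single b 1 ∈ A := by
  set x := m - Finsupp.single a 1 + Finsupp.single b 1 with hx
  have hxa : x a = m a - 1 := by simp [hx, hab]
  have hxb : x b = m b + 1 := by simp [hx, hab.symm]
  have hxc : ∀ c, c ≠ a → c ≠ b → x c = m c := fun c ha hb => by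
    simp [hx, Ne.symm ha, Ne.symm hb]
  rw [← hfix, mem_compress hab] at hm ⊢
  rw [fiber_congr (y := m) (by omega) hxc]
  omega

theorem exists_stronglyStable_card_iterSum_le (d : ℕ) (A : Finset (Fin n →₀ ℕ))
    (hA : ∀ m ∈ A, m.degree = d) :
    ∃ M : Finset (Fin n →₀ ℕ), IsStronglyStable d M ∧ M.card = A.card ∧
      ∀ i, (iterSum M i).card ≤ (iterSum A i).card := by
  -- A compression towards a smaller index that changes the set strictly lowers the total index
  -- weight, so compressing stops, and it stops at a set closed under all exchanges.
  induction hw : ∑ m ∈ A, indexWeight m using Nat.strong_induction_on generalizing A with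
  | _ w ih =>
    by_cases hfix : ∀ a b : Fin n, b < a → compress a b A = A
    · exact ⟨A, ⟨hA, fun m hm a b hma hba =>
        exchange_mem_of_compress_eq hba.ne' (hfix a b hba) hm hma⟩, rfl, fun _ => le_rfl⟩
    · push Not at hfix
      obtain ⟨a, b, hba, hne⟩ := hfix
      have hex : ∃ y ∈ A, fiberRank a b A y < y a := by
        by_contra! hcon
        refine hne ?_
        have hid : ∀ y ∈ A, compressFun a b A y = y := by
          intro y hy
          have hr : fiberRank a b A y = y a := le_antisymm (fiberRank_le A y) (hcon y hy)
          ext c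
          by_cases hca : c = a
          · rw [hca, compressFun_left hba.ne', hr]
          by_cases hcb : c = b
          · rw [hcb, compressFun_right, hr]; omega
          exact compressFun_of_ne A y hca hcb
        rw [compress, Finset.image_congr (g := id) fun y hy => hid y hy, Finset.image_id]
      have hle : ∀ y ∈ A, indexWeight (compressFun a b A y) ≤ indexWeight y := fun y _ => by
        rw [← indexWeight_compressFun hba A y]; omega
      have hlt : ∑ m ∈ compress a b A, indexWeight m < w := by
        rw [compress, Finset.sum_image fun x hx y hy h => ?_, ← hw]
        · obtain ⟨y, hy, hr⟩ := hex
          refine Finset.sum_lt_sum hle ⟨y, hy, ?_⟩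
          rw [← indexWeight_compressFun hba A y]
          have h1 : 0 < (a : ℕ) - b := Nat.sub_pos_of_lt hba
          have := Nat.mul_pos h1 (Nat.sub_pos_of_lt hr)
          omega
        · exact Finset.card_image_iff.1 (card_compress hba.ne' A) hx hy h
      have hdeg : ∀ m ∈ compress a b A, m.degree = d := by
        intro m hm
        obtain ⟨y, hy, rfl⟩ := Finset.mem_image.1 hm
        rw [degree_compressFun hba.ne', hA y hy]
      obtain ⟨M, hM, hMc, hMi⟩ := ih _ hlt _ hdeg rfl
      exact ⟨M, hM, hMc.trans (card_compress hba.ne' A), fun i =>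
        (hMi i).trans (card_iterSum_compress_le hba.ne' A i)⟩

end Compression

/-! ### Counting exponent vectors by competition of two groups of variables -/

section Counting

/-- The probability that fewer than `k` heads occur in `g + k - 1` tosses of a fair coin. -/
noncomputable def binomTail (k g : ℕ) : ℝ :=
  (∑ i ∈ Finset.range k, ((g + k - 1).choose i : ℝ)) / 2 ^ (g + k - 1)

theorem binomTail_zero_left (g : ℕ) : binomTail 0 g = 0 := by simp [binomTail]

theorem binomTail_succ_zero (k : ℕ) : binomTail (k + 1) 0 = 1 := by
  have h := Nat.sum_range_choose k
  have h' : ∑ i ∈ Finset.range (k + 1), (k.choose i : ℝ) = 2 ^ k := by exact_mod_cast h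
  rw [binomTail, show 0 + (k + 1) - 1 = k by omega, h', div_self (by positivity)]

theorem binomTail_nonneg (k g : ℕ) : 0 ≤ binomTail k g := by
  unfold binomTail; positivity

/-- Condition on one toss: heads lowers the number of heads still needed, tails the number of tails.
Formally this is Pascal's rule. -/
theorem binomTail_succ_succ (k g : ℕ) :
    2 * binomTail (k + 1) (g + 1) = binomTail k (g + 1) + binomTail (k + 1) g := by
  have h1 : ∑ i ∈ Finset.range (k + 1), ((g + k + 1).choose i : ℝ) =
      ∑ i ∈ Finset.range k, ((g + k).choose i : ℝ) +
        ∑ i ∈ Finset.range (k + 1), ((g + k).choose i : ℝ) := by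
    rw [Finset.sum_range_succ', Finset.sum_range_succ' (fun i => ((g + k).choose i : ℝ)),
      ← add_assoc, ← Finset.sum_add_distrib]
    simp [Nat.choose_succ_succ]
  rw [binomTail, binomTail, binomTail, show g + 1 + (k + 1) - 1 = g + k + 1 by omega,
    show g + 1 + k - 1 = g + k by omega, show g + (k + 1) - 1 = g + k by omega, h1, pow_succ]
  field_simp

/-- The exponent vectors of degree `d` whose total over `X` exceeds their total over `Y`. -/
def exceeding {n : ℕ} (X Y : Finset (Fin n)) (d : ℕ) : Finset (Fin n → ℕ) :=
  (Finset.univ.piAntidiag d).filter fun α => ∑ i ∈ Y, α i < ∑ i ∈ X, α i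

variable {n : ℕ}

theorem mem_exceeding {X Y : Finset (Fin n)} {d : ℕ} {α : Fin n → ℕ} :
    α ∈ exceeding X Y d ↔ ∑ i, α i = d ∧ ∑ i ∈ Y, α i < ∑ i ∈ X, α i := by
  simp [exceeding, Finset.mem_piAntidiag]

theorem card_piAntidiag_univ_fin_succ (m d : ℕ) :
    ((Finset.univ : Finset (Fin (m + 1))).piAntidiag d).card = (d + m).choose m := by
  have h := Finset.card_finsuppAntidiag_nat_eq_multichoose
    (s := (Finset.univ : Finset (Fin (m + 1)))) d
  rw [Finset.finsuppAntidiag, Finset.card_map, Finset.card_attach] at h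
  rw [h, Nat.multichoose_eq, Finset.card_univ, Fintype.card_fin,
    show m + 1 + d - 1 = d + m by omega, Nat.choose_symm_add]

theorem card_piAntidiag_mono {d e : ℕ} (hn : 0 < n) (h : d ≤ e) :
    ((Finset.univ : Finset (Fin n)).piAntidiag d).card ≤
      ((Finset.univ : Finset (Fin n)).piAntidiag e).card := by
  obtain ⟨m, rfl⟩ := Nat.exists_eq_succ_of_ne_zero hn.ne'
  rw [card_piAntidiag_univ_fin_succ, card_piAntidiag_univ_fin_succ]
  exact Nat.choose_le_choose m (by omega)

theorem two_mul_card_le_of_injOn {S T : Finset (Fin n → ℕ)}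
    (φ : (Fin n → ℕ) → ℕ → Fin n → ℕ) (hφ : ∀ α ∈ S, ∀ σ < 2, φ α σ ∈ T)
    (hinj : ∀ α ∈ S, ∀ β ∈ S, ∀ σ < 2, ∀ τ < 2, φ α σ = φ β τ → α = β ∧ σ = τ) :
    2 * S.card ≤ T.card := by
  rw [mul_comm, ← Finset.card_range 2, ← Finset.card_product]
  refine Finset.card_le_card_of_injOn (fun p => φ p.1 p.2) (fun p hp => ?_) ?_
  · have := Finset.mem_product.1 hp
    exact hφ _ this.1 _ (Finset.mem_range.1 this.2)
  · intro p hp q hq h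
    have hp' := Finset.mem_product.1 hp
    have hq' := Finset.mem_product.1 hq
    have := hinj _ hp'.1 _ hq'.1 _ (Finset.mem_range.1 hp'.2) _ (Finset.mem_range.1 hq'.2) h
    exact Prod.ext this.1 this.2

theorem sum_congr_of_agree {S : Finset (Fin n)} {α β : Fin n → ℕ} {P : Fin n → Prop}
    (h : ∀ i, ¬ P i → α i = β i) (hS : ∀ i ∈ S, ¬ P i) : ∑ i ∈ S, α i = ∑ i ∈ S, β i :=
  Finset.sum_congr rfl fun i hi => h i (hS i hi)

theorem sum_univ_eq_add_add {u v : Fin n} (huv : u ≠ v) (α : Fin n → ℕ) :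
    ∑ i, α i = α u + α v + ∑ i ∈ Finset.univ \ {u, v}, α i :=
  sum_eq_add_sum_compl_pair huv α

/-- Discrete memorylessness: when `α u ≤ α v`, cancel `α u` against `α v` and drop `u` from the
competition. The freed exponent `2 * α u + σ` at `u` records a bit `σ` by its parity, whence the
factor 2; the extra unit of degree goes to `u` or to some `x ∈ X`, where it only helps. -/
theorem two_mul_card_exceeding_right_le {X Y : Finset (Fin n)} {u v : Fin n} (d : ℕ)
    (huv : u ≠ v) (hu : u ∉ X) (hv : v ∉ Y) (huY : u ∉ Y) (hvX : v ∉ X) (hXY : Disjoint X Y) :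
    2 * ((exceeding (insert u X) (insert v Y) d).filter fun α => α u ≤ α v).card ≤
      (exceeding X (insert v Y) (d + 1)).card := by
  -- With `X` empty, `u` alone would have to exceed a total that includes `α v ≥ α u`.
  rcases X.eq_empty_or_nonempty with rfl | ⟨x, hx⟩
  · rw [Finset.card_eq_zero.2, mul_zero]
    · exact Nat.zero_le _
    · refine Finset.filter_eq_empty_iff.2 fun α hα => ?_
      have h := (mem_exceeding.1 hα).2
      rw [Finset.sum_insert hv, Finset.sum_insert hu] at h
      simp only [Finset.sum_empty] at h
      omega
  have hxu : x ≠ u := fun h => hu (h ▸ hx)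
  have hxv : x ≠ v := fun h => hvX (h ▸ hx)
  have hxY : x ∉ Y := Finset.disjoint_left.1 hXY hx
  let φ : (Fin n → ℕ) → ℕ → Fin n → ℕ := fun α σ i =>
    if i = u then 2 * α u + σ else if i = v then α v - α u else
      if i = x then α x + (1 - σ) else α i
  have h1 : ∀ α σ, φ α σ u = 2 * α u + σ := fun α σ => by simp [φ]
  have h2 : ∀ α σ, φ α σ v = α v - α u := fun α σ => by simp [φ, huv.symm]
  have h3 : ∀ α σ, φ α σ x = α x + (1 - σ) := fun α σ => by simp [φ, hxu, hxv]
  have h4 : ∀ α σ i, ¬ (i = u ∨ i = v ∨ i = x) → φ α σ i = α i := fun α σ i hi => by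
    simp only [not_or] at hi
    simp [φ, hi.1, hi.2.1, hi.2.2]
  have hx' : x ∈ Finset.univ \ {u, v} := by simp [hxu, hxv]
  refine two_mul_card_le_of_injOn φ (fun α hα σ hσ => ?_) fun α hα β hβ σ hσ τ hτ h => ?_
  · obtain ⟨hα, hle⟩ := Finset.mem_filter.1 hα
    rw [mem_exceeding, Finset.sum_insert hv, Finset.sum_insert hu, sum_univ_eq_add_add huv,
      ← Finset.add_sum_erase _ _ hx', ← Finset.add_sum_erase _ _ hx] at hα
    rw [mem_exceeding, Finset.sum_insert hv, sum_univ_eq_add_add huv,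
      ← Finset.add_sum_erase _ _ hx', ← Finset.add_sum_erase _ _ hx, h1, h2, h3,
      sum_congr_of_agree (h4 α σ) (S := Y) (fun i hi => ?_),
      sum_congr_of_agree (h4 α σ) (S := X.erase x) (fun i hi => ?_),
      sum_congr_of_agree (h4 α σ) (S := (Finset.univ \ {u, v}).erase x) (fun i hi => ?_)]
    · omega
    · simp only [Finset.mem_erase, Finset.mem_sdiff, Finset.mem_univ, Finset.mem_insert,
        Finset.mem_singleton, true_and] at hi
      tauto
    · rintro (rfl | rfl | rfl)
      · exact hu (Finset.mem_of_mem_erase hi)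
      · exact hvX (Finset.mem_of_mem_erase hi)
      · exact Finset.notMem_erase _ _ hi
    · rintro (rfl | rfl | rfl)
      · exact huY hi
      · exact hv hi
      · exact hxY hi
  · have hα := (Finset.mem_filter.1 hα).2
    have hβ := (Finset.mem_filter.1 hβ).2
    have e1 := congrFun h u
    have e2 := congrFun h v
    have e3 := congrFun h x
    rw [h1, h1] at e1
    rw [h2, h2] at e2
    rw [h3, h3] at e3
    refine ⟨funext fun i => ?_, by omega⟩
    by_cases hi : i = u ∨ i = v ∨ i = x
    · rcases hi with rfl | rfl | rfl <;> omega
    · rw [← h4 α σ i hi, h, h4 β τ i hi]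

/-- The mirror case `α v < α u`: `v` drops out and stores the bit in its parity. The surviving `u`
can itself receive the extra unit, so no auxiliary variable is needed. -/
theorem two_mul_card_exceeding_left_le {X Y : Finset (Fin n)} {u v : Fin n} (d : ℕ)
    (huv : u ≠ v) (hu : u ∉ X) (hv : v ∉ Y) (huY : u ∉ Y) (hvX : v ∉ X) :
    2 * ((exceeding (insert u X) (insert v Y) d).filter fun α => ¬ α u ≤ α v).card ≤
      (exceeding (insert u X) Y (d + 1)).card := by
  let φ : (Fin n → ℕ) → ℕ → Fin n → ℕ := fun α σ i =>
    if i = u then α u - α v + (1 - σ) else if i = v then 2 * α v + σ else α i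
  have h1 : ∀ α σ, φ α σ u = α u - α v + (1 - σ) := fun α σ => by simp [φ]
  have h2 : ∀ α σ, φ α σ v = 2 * α v + σ := fun α σ => by simp [φ, huv.symm]
  have h4 : ∀ α σ i, ¬ (i = u ∨ i = v) → φ α σ i = α i := fun α σ i hi => by
    simp only [not_or] at hi
    simp [φ, hi.1, hi.2]
  refine two_mul_card_le_of_injOn φ (fun α hα σ hσ => ?_) fun α hα β hβ σ hσ τ hτ h => ?_
  · obtain ⟨hα, hle⟩ := Finset.mem_filter.1 hα
    rw [mem_exceeding, Finset.sum_insert hv, Finset.sum_insert hu, sum_univ_eq_add_add huv] at hα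
    rw [mem_exceeding, Finset.sum_insert hu, sum_univ_eq_add_add huv, h1, h2,
      sum_congr_of_agree (h4 α σ) (S := Y) (fun i hi => ?_),
      sum_congr_of_agree (h4 α σ) (S := X) (fun i hi => ?_),
      sum_congr_of_agree (h4 α σ) (S := Finset.univ \ {u, v}) (fun i hi => ?_)]
    · omega
    · simpa using hi
    · rintro (rfl | rfl)
      · exact hu hi
      · exact hvX hi
    · rintro (rfl | rfl)
      · exact huY hi
      · exact hv hi
  · have hα := (Finset.mem_filter.1 hα).2
    have hβ := (Finset.mem_filter.1 hβ).2
    have e1 := congrFun h u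
    have e2 := congrFun h v
    rw [h1, h1] at e1
    rw [h2, h2] at e2
    refine ⟨funext fun i => ?_, by omega⟩
    by_cases hi : i = u ∨ i = v
    · rcases hi with rfl | rfl <;> omega
    · rw [← h4 α σ i hi, h, h4 β τ i hi]

/-- The proportion of exponent vectors whose total over `X` exceeds that over `Y` is at most the
binomial tail probability, up to a shift of the degree. -/
theorem card_exceeding_le (hn : 0 < n) (X Y : Finset (Fin n)) (hXY : Disjoint X Y) (d : ℕ) :
    ((exceeding X Y d).card : ℝ) ≤ binomTail X.card Y.card *
      ((Finset.univ : Finset (Fin n)).piAntidiag (d + X.card + Y.card)).card := by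
  induction hN : X.card + Y.card generalizing X Y d with
  | zero =>
    have hX : X = ∅ := Finset.card_eq_zero.1 (by omega)
    subst hX
    simp [exceeding, binomTail_zero_left]
  | succ N ih =>
    rcases X.eq_empty_or_nonempty with rfl | ⟨u, huX⟩
    · simp [exceeding, binomTail_zero_left]
    rcases Y.eq_empty_or_nonempty with rfl | ⟨v, hvY⟩
    -- Without opponents the tail is 1 and the bound is trivial.
    · obtain ⟨k, hk⟩ := Nat.exists_eq_succ_of_ne_zero (Finset.card_ne_zero_of_mem huX)
      rw [hk, Finset.card_empty, binomTail_succ_zero, one_mul, Nat.cast_le]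
      exact (Finset.card_filter_le _ _).trans (card_piAntidiag_mono hn (by omega))
    obtain ⟨X, hu, rfl⟩ : ∃ X', u ∉ X' ∧ X = insert u X' :=
      ⟨X.erase u, Finset.notMem_erase u X, (Finset.insert_erase huX).symm⟩
    obtain ⟨Y, hv, rfl⟩ : ∃ Y', v ∉ Y' ∧ Y = insert v Y' :=
      ⟨Y.erase v, Finset.notMem_erase v Y, (Finset.insert_erase hvY).symm⟩
    have hXY1 : Disjoint X (insert v Y) :=
      hXY.mono_left (Finset.subset_insert _ _)
    have hXY2 : Disjoint (insert u X) Y :=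
      hXY.mono_right (Finset.subset_insert _ _)
    have huY : u ∉ Y := fun h => Finset.disjoint_left.1 hXY2 huX h
    have hvX : v ∉ X := fun h => Finset.disjoint_left.1 hXY1 h hvY
    have huv : u ≠ v := fun h => Finset.disjoint_left.1 hXY huX (h ▸ hvY)
    have e1 := two_mul_card_exceeding_right_le d huv hu hv huY hvX
      (hXY1.mono_right (Finset.subset_insert _ _))
    have e2 := two_mul_card_exceeding_left_le d huv hu hv huY hvX
    have e3 := Finset.card_filter_add_card_filter_not
      (s := exceeding (insert u X) (insert v Y) d) (fun α => α u ≤ α v)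
    have cX := Finset.card_insert_of_notMem hu
    have cY := Finset.card_insert_of_notMem hv
    have i1 := ih X (insert v Y) hXY1 (d + 1) (by omega)
    have i2 := ih (insert u X) Y hXY2 (d + 1) (by omega)
    have e4 : 2 * ((exceeding (insert u X) (insert v Y) d).card : ℝ) ≤
        (exceeding X (insert v Y) (d + 1)).card + (exceeding (insert u X) Y (d + 1)).card := by
      exact_mod_cast (show 2 * (exceeding (insert u X) (insert v Y) d).card ≤
        (exceeding X (insert v Y) (d + 1)).card + (exceeding (insert u X) Y (d + 1)).card by omega)
    have hrec := binomTail_succ_succ X.card Y.card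
    rw [cX, cY] at *
    rw [show d + 1 + X.card + (Y.card + 1) = d + (X.card + 1) + (Y.card + 1) by omega] at i1
    rw [show d + 1 + (X.card + 1) + Y.card = d + (X.card + 1) + (Y.card + 1) by omega] at i2
    have e5 := e4.trans (add_le_add i1 i2)
    rw [← add_mul, ← hrec] at e5
    linarith

/-- Halve the exponent at `v` and give the rest to `u`: both sides gain at least equally in favour
of `u`, the degree is kept, and the lost parity accounts for the factor 2. -/
theorem card_exceeding_singleton_le {Y : Finset (Fin n)} {u v : Fin n} (d : ℕ)
    (huv : u ≠ v) (huY : u ∉ Y) (hv : v ∉ Y) :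
    (exceeding {u} Y d).card ≤ 2 * (exceeding {u} (insert v Y) d).card := by
  rw [mul_comm, ← Finset.card_range 2, ← Finset.card_product]
  let φ : (Fin n → ℕ) → Fin n → ℕ := fun α i =>
    if i = u then α u + α v / 2 + α v % 2 else if i = v then α v / 2 else α i
  have h1 : ∀ α, φ α u = α u + α v / 2 + α v % 2 := fun α => by simp [φ]
  have h2 : ∀ α, φ α v = α v / 2 := fun α => by simp [φ, huv.symm]
  have h4 : ∀ α i, ¬ (i = u ∨ i = v) → φ α i = α i := fun α i hi => by
    simp only [not_or] at hi
    simp [φ, hi.1, hi.2]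
  refine Finset.card_le_card_of_injOn (fun α => (φ α, α v % 2)) (fun α hα => ?_) ?_
  · refine Finset.mem_product.2 ⟨?_, Finset.mem_range.2 (Nat.mod_lt _ two_pos)⟩
    rw [Finset.mem_coe, mem_exceeding, Finset.sum_singleton, sum_univ_eq_add_add huv] at hα
    change φ α ∈ exceeding _ _ _
    rw [mem_exceeding, Finset.sum_insert hv, Finset.sum_singleton, sum_univ_eq_add_add huv, h1, h2,
      sum_congr_of_agree (h4 α) (S := Y) (fun i hi => ?_),
      sum_congr_of_agree (h4 α) (S := Finset.univ \ {u, v}) (fun i hi => ?_)]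
    · omega
    · simpa using hi
    · rintro (rfl | rfl)
      · exact huY hi
      · exact hv hi
  · intro α hα β hβ h
    have hφ := (Prod.ext_iff.1 h).1
    have hm : α v % 2 = β v % 2 := (Prod.ext_iff.1 h).2
    have e1 : φ α u = φ β u := congrFun hφ u
    have e2 : φ α v = φ β v := congrFun hφ v
    rw [h1, h1] at e1
    rw [h2, h2] at e2
    funext i
    by_cases hi : i = u ∨ i = v
    · rcases hi with rfl | rfl <;> omega
    · rw [← h4 α i hi, ← h4 β i hi]; exact congrFun hφ i

/-- The lower bound for what RevLex misses: one variable beats `Y` with proportion about `2 ^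
(-|Y|)`. The unit added to the degree makes `u` positive when `Y` is empty. -/
theorem card_piAntidiag_le_two_pow_mul_card_exceeding (u : Fin n) (Y : Finset (Fin n))
    (huY : u ∉ Y) (d : ℕ) :
    ((Finset.univ : Finset (Fin n)).piAntidiag d).card ≤
      2 ^ Y.card * (exceeding {u} Y (d + 1)).card := by
  induction Y using Finset.induction_on with
  | empty =>
    rw [Finset.card_empty, pow_zero, one_mul]
    refine Finset.card_le_card_of_injOn (fun α => α + Pi.single u 1) (fun α hα => ?_)
      fun α _ β _ h => add_right_cancel h
    simp only [Finset.mem_coe, Finset.mem_piAntidiag] at hα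
    simp [mem_exceeding, Finset.sum_add_distrib, hα.1]
  | insert v Y hv ih =>
    simp only [Finset.mem_insert, not_or] at huY
    rw [Finset.card_insert_of_notMem hv, pow_succ, mul_assoc]
    exact (ih huY.2).trans
      (Nat.mul_le_mul_left _ (card_exceeding_singleton_le _ huY.1 huY.2 hv))

end Counting

/-! ### Bounds for binomial tails and ratios of binomial coefficients -/

section Estimates

theorem binomTail_le_succ_left (k g : ℕ) : binomTail k g ≤ binomTail (k + 1) g := by
  induction g generalizing k with
  | zero =>
    cases k with
    | zero => rw [binomTail_zero_left]; exact binomTail_nonneg _ _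
    | succ k => rw [binomTail_succ_zero, binomTail_succ_zero]
  | succ g ihg =>
    induction k with
    | zero => rw [binomTail_zero_left]; exact binomTail_nonneg _ _
    | succ k ihk =>
      have h1 := binomTail_succ_succ k g
      have h2 := binomTail_succ_succ (k + 1) g
      have h3 := ihg (k + 1)
      linarith

theorem binomTail_antitone (k : ℕ) : Antitone (binomTail k) := by
  refine antitone_nat_of_succ_le fun g => ?_
  cases k with
  | zero => rw [binomTail_zero_left, binomTail_zero_left]
  | succ k =>
    have h1 := binomTail_succ_succ k g
    have h2 := binomTail_le_succ_left k (g + 1)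
    linarith

theorem binomTail_le_two_pow_mul (k g t : ℕ) : binomTail k g ≤ 2 ^ t * binomTail k (g + t) := by
  induction t with
  | zero => simp
  | succ t ih =>
    have h : binomTail k (g + t) ≤ 2 * binomTail k (g + t + 1) := by
      cases k with
      | zero => simp [binomTail_zero_left]
      | succ k =>
        have h1 := binomTail_succ_succ k (g + t)
        have h2 := binomTail_nonneg k (g + t + 1)
        linarith
    calc binomTail k g ≤ 2 ^ t * binomTail k (g + t) := ih
      _ ≤ 2 ^ t * (2 * binomTail k (g + t + 1)) := by gcongr
      _ = 2 ^ (t + 1) * binomTail k (g + (t + 1)) := by rw [pow_succ, mul_assoc]; rfl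

/-- Since `1/8 + 15/8 = 2`, the right side solves the recurrence of `binomTail`, and it dominates on
the boundary. -/
theorem binomTail_le_pow_mul_pow (k g : ℕ) : binomTail k g ≤ 8 ^ k * (8 / 15) ^ g := by
  induction g generalizing k with
  | zero =>
    cases k with
    | zero => simp [binomTail_zero_left]
    | succ k =>
      rw [binomTail_succ_zero, pow_zero, mul_one]
      exact one_le_pow₀ (by norm_num)
  | succ g ihg =>
    induction k with
    | zero => rw [binomTail_zero_left]; positivity
    | succ k ihk =>
      have h1 := binomTail_succ_succ k g
      have h2 := ihg (k + 1)
      have h3 : (8 : ℝ) ^ k * (8 / 15) ^ (g + 1) + 8 ^ (k + 1) * (8 / 15) ^ g =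
          2 * (8 ^ (k + 1) * (8 / 15) ^ (g + 1)) := by ring
      linarith

/-- The left side bounds a geometric sum of the estimates `8 ^ k * (8 / 15) ^ g`. Passing from `p`
to `p + 1` multiplies it by `8 * (8 / 15) ^ p ≤ 1`. The inequality fails at `p = 8`, so smaller `p`
need exact values. -/
theorem pow_mul_pow_choose_two_le (p : ℕ) (hp : 9 ≤ p) :
    (8 : ℝ) ^ (p + 1) / 7 * (8 / 15) ^ (50 + p.choose 2) ≤ 3 / 4 / 2 ^ 50 := by
  induction p, hp using Nat.le_induction with
  | base => norm_num [Nat.choose]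
  | succ p hp ih =>
    refine le_trans ?_ ih
    have h1 : (p + 1).choose 2 = p + p.choose 2 := by
      rw [Nat.choose_succ_succ' p 1, Nat.choose_one_right]
    have h2 : (8 / 15 : ℝ) ^ p ≤ 1 / 8 :=
      (pow_le_pow_of_le_one (by norm_num) (by norm_num) hp).trans (by norm_num)
    rw [h1, show 50 + (p + p.choose 2) = 50 + p.choose 2 + p by ring]
    calc (8 : ℝ) ^ (p + 1 + 1) / 7 * (8 / 15) ^ (50 + p.choose 2 + p)
        = 8 ^ (p + 1) / 7 * (8 / 15) ^ (50 + p.choose 2) * (8 * (8 / 15) ^ p) := by ring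
      _ ≤ 8 ^ (p + 1) / 7 * (8 / 15) ^ (50 + p.choose 2) * (8 * (1 / 8)) := by gcongr
      _ = _ := by ring

/-- The extreme case of the constraints at `r = 50`: the maximum is the least admissible `s`, and
the quotient, rounded up by the summand `k`, the least admissible `g k`. -/
theorem sum_binomTail_le_of_two_le_of_le_eight (p : ℕ) (h2 : 2 ≤ p) (h8 : p ≤ 8) :
    ∑ k ∈ Finset.range p, binomTail (k + 1)
      ((max (80 - p) (50 + p.choose 2) * k + p.choose 2 + 50 + k) / (k + 1)) ≤ 3 / 4 / 2 ^ 50 := by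
  interval_cases p <;> norm_num [binomTail, Finset.sum_range_succ, Nat.choose]

theorem sum_binomTail_le_aux (p s : ℕ) (g : ℕ → ℕ) (hp : 2 ≤ p) (hs : 80 ≤ s + p)
    (hs' : 50 + p.choose 2 ≤ s)
    (hg : ∀ k < p, s * k + p.choose 2 + 50 ≤ (k + 1) * g k) :
    ∑ k ∈ Finset.range p, binomTail (k + 1) (g k) ≤ 3 / 4 / 2 ^ 50 := by
  rcases le_or_gt p 8 with h8 | h8
  · refine le_trans (Finset.sum_le_sum fun k hk => ?_)
      (sum_binomTail_le_of_two_le_of_le_eight p hp h8)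
    refine binomTail_antitone _ (Nat.le_of_lt_succ ?_)
    rw [Nat.div_lt_iff_lt_mul (Nat.succ_pos k)]
    have h1 := hg k (Finset.mem_range.1 hk)
    have h2 : max (80 - p) (50 + p.choose 2) * k ≤ s * k :=
      Nat.mul_le_mul_right _ (max_le (by omega) hs')
    nlinarith
  -- Here `s ≥ 50 + p.choose 2` gives `g k ≥ 50 + p.choose 2` for every `k`.
  · refine le_trans (le_trans (Finset.sum_le_sum (g := fun k : ℕ =>
      (8 : ℝ) ^ (k + 1) * (8 / 15) ^ (50 + p.choose 2)) fun k hk => ?_) ?_)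
      (pow_mul_pow_choose_two_le p h8)
    · refine le_trans (binomTail_antitone _ ?_) (binomTail_le_pow_mul_pow _ _)
      have h1 := hg k (Finset.mem_range.1 hk)
      have h2 : (50 + p.choose 2) * k ≤ s * k := Nat.mul_le_mul_right _ hs'
      refine Nat.le_of_mul_le_mul_left (?_ : (k + 1) * _ ≤ _) (Nat.succ_pos k)
      nlinarith
    · rw [← Finset.sum_mul]
      refine mul_le_mul_of_nonneg_right ?_ (by positivity)
      have h := geom_sum_eq (show (8 : ℝ) ≠ 1 by norm_num) p
      simp only [pow_succ]
      rw [← Finset.sum_mul, h]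
      have : (0 : ℝ) < 8 ^ p := by positivity
      linarith

/-- The tail probabilities belonging to a non-RevLex strongly stable set are together smaller
than the one belonging to the RevLex set. -/
theorem sum_binomTail_le (r p s : ℕ) (g : ℕ → ℕ) (hr : r ≤ 50) (hp : 2 ≤ p)
    (hs : r + 30 ≤ s + p) (hs' : r + p.choose 2 ≤ s)
    (hg : ∀ k < p, s * k + p.choose 2 + r ≤ (k + 1) * g k) :
    ∑ k ∈ Finset.range p, binomTail (k + 1) (g k) ≤ 3 / 4 / 2 ^ r := by
  obtain ⟨t, ht⟩ := Nat.exists_eq_add_of_le hr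
  -- Reduction to `r = 50`: adding `t = 50 - r` to `s` and to each `g k` preserves the constraints
  -- and costs a factor `2 ^ t`.
  have h := sum_binomTail_le_aux p (s + t) (fun k => g k + t) hp (by omega) (by omega)
    fun k hk => by nlinarith [hg k hk]
  calc ∑ k ∈ Finset.range p, binomTail (k + 1) (g k)
      ≤ ∑ k ∈ Finset.range p, 2 ^ t * binomTail (k + 1) (g k + t) :=
        Finset.sum_le_sum fun k _ => binomTail_le_two_pow_mul _ _ _
    _ = 2 ^ t * ∑ k ∈ Finset.range p, binomTail (k + 1) (g k + t) := by rw [Finset.mul_sum]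
    _ ≤ 2 ^ t * (3 / 4 / 2 ^ 50) := by gcongr
    _ = 3 / 4 / 2 ^ r := by rw [ht, pow_add]; field_simp

/-- Factor by factor, `(d + L + j) / (d + j) ≤ (d + L + 1) / (d + 1)` for `j ≥ 1`. -/
theorem choose_mul_pow_le (d L m : ℕ) :
    (d + L + m).choose m * (d + 1) ^ m ≤ (d + m).choose m * (d + L + 1) ^ m := by
  induction m with
  | zero => simp
  | succ m ih =>
    have h1 := Nat.add_one_mul_choose_eq (d + L + m) m
    have h2 := Nat.add_one_mul_choose_eq (d + m) m
    refine Nat.le_of_mul_le_mul_left (?_ : (m + 1) * _ ≤ (m + 1) * _) (Nat.succ_pos m)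
    calc (m + 1) * ((d + L + (m + 1)).choose (m + 1) * (d + 1) ^ (m + 1))
        = ((d + L + m + 1).choose (m + 1) * (m + 1)) * (d + 1) ^ (m + 1) := by
          rw [← add_assoc]; ring
      _ = ((d + L + m + 1) * (d + 1)) * ((d + L + m).choose m * (d + 1) ^ m) := by
          rw [← h1]; ring
      _ ≤ ((d + m + 1) * (d + L + 1)) * ((d + m).choose m * (d + L + 1) ^ m) := by
          refine Nat.mul_le_mul ?_ ih
          nlinarith [Nat.zero_le (L * m)]
      _ = ((d + m + 1) * (d + m).choose m) * (d + L + 1) ^ (m + 1) := by ring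
      _ = (m + 1) * ((d + (m + 1)).choose (m + 1) * (d + L + 1) ^ (m + 1)) := by
          rw [h2, ← add_assoc]; ring

theorem exists_forall_three_mul_choose_le (L m : ℕ) :
    ∃ N, ∀ d, N ≤ d → 3 / 4 * ((d + L + m).choose m : ℝ) ≤ ((d + m).choose m : ℝ) := by
  have hlim : Filter.Tendsto (fun d : ℕ => (1 + (L : ℝ) * (1 / ((d : ℝ) + 1))) ^ m)
      Filter.atTop (nhds 1) := by
    have h := ((tendsto_one_div_add_atTop_nhds_zero_nat (𝕜 := ℝ)).const_mul (L : ℝ)).const_add 1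
    simpa using h.pow m
  have hev := hlim.eventually (ge_mem_nhds (show (1 : ℝ) < 4 / 3 by norm_num))
  obtain ⟨N, hN⟩ := Filter.eventually_atTop.1 hev
  refine ⟨N, fun d hd => ?_⟩
  have h1 : ((d + L + m).choose m : ℝ) * ((d : ℝ) + 1) ^ m ≤
      (d + m).choose m * ((d : ℝ) + L + 1) ^ m := by exact_mod_cast choose_mul_pow_le d L m
  have hpos : (0 : ℝ) < (d : ℝ) + 1 := by positivity
  have h2 : ((d : ℝ) + L + 1) ^ m = (1 + (L : ℝ) * (1 / ((d : ℝ) + 1))) ^ m * ((d : ℝ) + 1) ^ m := by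
    rw [← mul_pow]; congr 1; field_simp; ring
  rw [h2, ← mul_assoc] at h1
  have h3 := le_of_mul_le_mul_right h1 (by positivity)
  have h4 := mul_le_mul_of_nonneg_left (hN d hd) (Nat.cast_nonneg (α := ℝ) ((d + m).choose m))
  linarith

end Estimates

/-! ### Structure and powers of strongly stable sets of quadratic monomials -/

section StronglyStable

variable {n : ℕ}

/-- The exponent vector of the monomial `x_a x_b`. -/
noncomputable def pairExp (a b : Fin n) : Fin n →₀ ℕ := Finsupp.single a 1 + Finsupp.single b 1

theorem pairExp_comm (a b : Fin n) : pairExp a b = pairExp b a := add_comm _ _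

theorem exists_pairExp_eq {m : Fin n →₀ ℕ} (hm : m.degree = 2) :
    ∃ a b, a ≤ b ∧ m = pairExp a b := by
  have hne : ∀ {k : ℕ} {x : Fin n →₀ ℕ}, x.degree = k + 1 →
      ∃ a y, x = Finsupp.single a 1 + y ∧ y.degree = k := by
    intro k x hx
    obtain ⟨a, ha⟩ : ∃ a, x a ≠ 0 := by
      by_contra! h
      have : x = 0 := Finsupp.ext h
      simp [this] at hx
    have hle : Finsupp.single a 1 ≤ x := by
      rw [Finsupp.single_le_iff]; omega
    have he : x = Finsupp.single a 1 + (x - Finsupp.single a 1) := (add_tsub_cancel_of_le hle).symm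
    refine ⟨a, _, he, ?_⟩
    have h := congrArg Finsupp.degree he
    rw [map_add, Finsupp.degree_single, hx] at h
    omega
  obtain ⟨a, y, rfl, hy⟩ := hne hm
  obtain ⟨b, z, rfl, hz⟩ := hne hy
  have hz0 : z = 0 := (Finsupp.degree_eq_zero_iff z).1 hz
  subst hz0
  rw [add_zero]
  rcases le_total a b with h | h
  · exact ⟨a, b, h, rfl⟩
  · exact ⟨b, a, h, add_comm _ _⟩

theorem IsStronglyStable.pairExp_mem_of_le_left {M : Finset (Fin n →₀ ℕ)}
    (hM : IsStronglyStable 2 M) {a a' b : Fin n} (h : pairExp a b ∈ M) (ha : a' ≤ a) :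
    pairExp a' b ∈ M := by
  rcases ha.eq_or_lt with rfl | hlt
  · exact h
  have h1 := hM.2 _ h a a' (by simp [pairExp]) hlt
  rwa [pairExp, add_tsub_cancel_left, add_comm] at h1

theorem IsStronglyStable.pairExp_mem_of_le_right {M : Finset (Fin n →₀ ℕ)}
    (hM : IsStronglyStable 2 M) {a b b' : Fin n} (h : pairExp a b ∈ M) (hb : b' ≤ b) :
    pairExp a b' ∈ M := by
  rw [pairExp_comm] at h ⊢
  exact hM.pairExp_mem_of_le_left h hb

theorem mem_iff_lt_card_of_isLowerSet {S : Finset (Fin n)}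
    (hS : ∀ a ∈ S, ∀ b, b ≤ a → b ∈ S) (a : Fin n) : a ∈ S ↔ (a : ℕ) < S.card := by
  constructor
  · intro ha
    have h : Finset.Iic a ⊆ S := fun b hb => hS a ha b (Finset.mem_Iic.1 hb)
    have := Finset.card_le_card h
    rw [Fin.card_Iic] at this
    omega
  · intro ha
    by_contra hna
    have h : S ⊆ Finset.Iio a := fun b hb => Finset.mem_Iio.2 <| by
      by_contra hle
      exact hna (hS b hb a (not_lt.1 hle))
    have := Finset.card_le_card h
    rw [Fin.card_Iio] at this
    omega

open Classical in
/-- The number of variables `x_a` with `x_a x_j` in `M`. -/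
noncomputable def nbrCount (M : Finset (Fin n →₀ ℕ)) (j : ℕ) : ℕ :=
  (Finset.univ.filter fun a : Fin n => ∃ b : Fin n, (b : ℕ) = j ∧ pairExp a b ∈ M).card

open Classical in
/-- The number of variables whose square is in `M`. -/
noncomputable def loopCount (M : Finset (Fin n →₀ ℕ)) : ℕ :=
  (Finset.univ.filter fun a : Fin n => pairExp a a ∈ M).card

theorem loopCount_le (M : Finset (Fin n →₀ ℕ)) : loopCount M ≤ n :=
  (Finset.card_filter_le _ _).trans (by simp)

variable {M : Finset (Fin n →₀ ℕ)}

theorem IsStronglyStable.pairExp_mem_iff (hM : IsStronglyStable 2 M) (a b : Fin n) :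
    pairExp a b ∈ M ↔ (a : ℕ) < nbrCount M b := by
  classical
  rw [nbrCount, ← mem_iff_lt_card_of_isLowerSet]
  · simp only [Finset.mem_filter, Finset.mem_univ, true_and]
    constructor
    · exact fun h => ⟨b, rfl, h⟩
    · rintro ⟨c, hc, h⟩
      rwa [Fin.ext hc] at h
  · simp only [Finset.mem_filter, Finset.mem_univ, true_and]
    rintro x ⟨c, hc, h⟩ y hy
    exact ⟨c, hc, hM.pairExp_mem_of_le_left h hy⟩

theorem IsStronglyStable.pairExp_self_mem_iff (hM : IsStronglyStable 2 M) (a : Fin n) :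
    pairExp a a ∈ M ↔ (a : ℕ) < loopCount M := by
  classical
  rw [loopCount, ← mem_iff_lt_card_of_isLowerSet]
  · simp
  · simp only [Finset.mem_filter, Finset.mem_univ, true_and]
    exact fun x hx y hy => hM.pairExp_mem_of_le_left (hM.pairExp_mem_of_le_right hx hy) hy

theorem IsStronglyStable.nbrCount_antitone (hM : IsStronglyStable 2 M) {i j : ℕ} (hij : i ≤ j) :
    nbrCount M j ≤ nbrCount M i := by
  classical
  refine Finset.card_le_card fun a ha => ?_
  simp only [Finset.mem_filter, Finset.mem_univ, true_and] at ha ⊢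
  obtain ⟨b, rfl, h⟩ := ha
  exact ⟨⟨i, by omega⟩, rfl, hM.pairExp_mem_of_le_right h hij⟩

/-- If `x_a x_j ∈ M`, lowering the larger index puts the square of the smaller variable in `M`; as
`x_j ^ 2 ∉ M`, that variable is `x_a`. -/
theorem IsStronglyStable.nbrCount_le_loopCount (hM : IsStronglyStable 2 M) {j : ℕ}
    (hj : loopCount M ≤ j) : nbrCount M j ≤ loopCount M := by
  classical
  refine Finset.card_le_card fun a ha => ?_
  simp only [Finset.mem_filter, Finset.mem_univ, true_and] at ha ⊢
  obtain ⟨b, rfl, h⟩ := ha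
  rcases le_total a b with hab | hab
  · exact hM.pairExp_mem_of_le_right h hab
  · have hb := hM.pairExp_mem_of_le_left h hab
    rw [hM.pairExp_self_mem_iff] at hb
    omega

theorem card_filter_lt_fun (h : ℕ → ℕ) (hh : ∀ y < n, h y ≤ n) :
    (Finset.univ.filter fun q : Fin n × Fin n => (q.1 : ℕ) < h q.2).card =
      ∑ y ∈ Finset.range n, h y := by
  rw [Finset.card_filter, Fintype.sum_prod_type_right, ← Fin.sum_univ_eq_sum_range]
  refine Finset.sum_congr rfl fun y _ => ?_
  rw [← Finset.card_filter]
  exact Fin.card_filter_val_lt.trans (min_eq_right (hh y y.2))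

/-- Sort the monomials by their larger index `j`; the smaller one is then below both bounds. -/
theorem IsStronglyStable.card_le (hM : IsStronglyStable 2 M) :
    M.card ≤ ∑ j ∈ Finset.range n, min (nbrCount M j) (j + 1) := by
  classical
  rw [← card_filter_lt_fun (n := n) _ fun y hy => (min_le_right _ _).trans hy]
  refine le_trans (Finset.card_le_card (t := Finset.image (fun q => pairExp q.1 q.2) _)
    fun m hm => ?_) Finset.card_image_le
  obtain ⟨a, b, hab, rfl⟩ := exists_pairExp_eq (hM.1 m hm)
  rw [hM.pairExp_mem_iff] at hm
  refine Finset.mem_image.2 ⟨(a, b), Finset.mem_filter.2 ⟨Finset.mem_univ _, ?_⟩, rfl⟩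
  exact lt_min hm (Nat.lt_succ_of_le hab)

/-- The variables with index at least `j`. -/
def tailVars (n j : ℕ) : Finset (Fin n) := Finset.univ.filter fun a : Fin n => j ≤ (a : ℕ)

/-- The variables with index less than `j`. -/
def headVars (n j : ℕ) : Finset (Fin n) := Finset.univ.filter fun a : Fin n => (a : ℕ) < j

theorem mem_tailVars {j : ℕ} {a : Fin n} : a ∈ tailVars n j ↔ j ≤ (a : ℕ) := by simp [tailVars]

theorem mem_headVars {j : ℕ} {a : Fin n} : a ∈ headVars n j ↔ (a : ℕ) < j := by simp [headVars]

theorem card_headVars {j : ℕ} (hj : j ≤ n) : (headVars n j).card = j := by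
  rw [headVars, Fin.card_filter_val_lt, min_eq_right hj]

theorem card_tailVars {j : ℕ} (hj : j ≤ n) : (tailVars n j).card = n - j := by
  have h := Finset.card_filter_add_card_filter_not (s := (Finset.univ : Finset (Fin n)))
    (fun a : Fin n => (a : ℕ) < j)
  rw [Fin.card_filter_val_lt, min_eq_right hj, Finset.card_univ, Fintype.card_fin] at h
  simp only [not_lt] at h
  rw [tailVars]
  omega

theorem sum_pairExp (S : Finset (Fin n)) (a b : Fin n) :
    ∑ c ∈ S, pairExp a b c = (if a ∈ S then 1 else 0) + if b ∈ S then 1 else 0 := by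
  simp [pairExp, Finset.sum_add_distrib, Finsupp.single_apply]

/-- A criterion for an exponent vector to be a sum of `i` elements of a strongly stable set. -/
theorem IsStronglyStable.mem_iterSum (hM : IsStronglyStable 2 M) (i : ℕ) (α : Fin n →₀ ℕ)
    (hα : α.degree = 2 * i)
    (h : ∀ j, loopCount M ≤ j → j < n →
      ∑ c ∈ tailVars n j, α c ≤ ∑ c ∈ headVars n (nbrCount M j), α c) :
    α ∈ iterSum M i := by
  classical
  induction i generalizing α with
  | zero =>
    have h0 : α = 0 := (Finsupp.degree_eq_zero_iff α).1 hα
    simp [iterSum, h0]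
  | succ i ih =>
    -- Greedy pairing: split off a generator containing the largest variable `x_j` of `α`. If `x_j ^
    -- 2 ∈ M`, any remaining variable is a valid partner; otherwise the hypothesis at `j` provides a
    -- neighbour.
    have hne : α.support.Nonempty := by
      rw [Finsupp.support_nonempty_iff]
      rintro rfl
      simp at hα
    obtain ⟨j, hj, hmax⟩ := α.support.exists_max_image id hne
    have hj0 : α j ≠ 0 := Finsupp.mem_support_iff.1 hj
    have hgt : ∀ c, j < c → α c = 0 := fun c hc => by
      by_contra h0
      exact absurd (hmax c (Finsupp.mem_support_iff.2 h0)) (not_le.2 hc)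
    have hex : ∃ a β, α = β + pairExp a j ∧ pairExp a j ∈ M ∧
        (loopCount M ≤ j → (a : ℕ) < loopCount M) := by
      have hlej : Finsupp.single j 1 ≤ α := by rw [Finsupp.single_le_iff]; omega
      obtain ⟨γ, hγ⟩ := exists_add_of_le hlej
      have hγd : γ.degree = 2 * i + 1 := by
        have := congrArg Finsupp.degree hγ
        rw [map_add, Finsupp.degree_single, hα] at this
        omega
      suffices hs : ∃ a, γ a ≠ 0 ∧ pairExp a j ∈ M ∧ (loopCount M ≤ j → (a : ℕ) < loopCount M) by
        obtain ⟨a, ha, haM, hal⟩ := hs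
        have hlea : Finsupp.single a 1 ≤ γ := by rw [Finsupp.single_le_iff]; omega
        obtain ⟨β, rfl⟩ := exists_add_of_le hlea
        exact ⟨a, β, by rw [hγ, pairExp]; abel, haM, hal⟩
      by_cases hjl : (j : ℕ) < loopCount M
      · obtain ⟨a, ha⟩ : ∃ a, γ a ≠ 0 := by
          by_contra! h0
          have : γ = 0 := Finsupp.ext h0
          simp [this] at hγd
        refine ⟨a, ha, ?_, fun h => absurd hjl (not_lt.2 h)⟩
        have haj : a ≤ j := by
          by_contra hlt
          have := hgt a (not_le.1 hlt)
          rw [hγ, Finsupp.add_apply] at this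
          omega
        exact hM.pairExp_mem_of_le_left ((hM.pairExp_self_mem_iff j).2 hjl) haj
      · have h1 := h j (not_lt.1 hjl) j.2
        have h2 : α j ≤ ∑ c ∈ tailVars n j, α c :=
          Finset.single_le_sum (f := fun c => α c) (fun _ _ => Nat.zero_le _)
            (mem_tailVars.2 le_rfl)
        obtain ⟨a, ha, ha0⟩ := Finset.exists_ne_zero_of_sum_ne_zero
          (show ∑ c ∈ headVars n (nbrCount M j), α c ≠ 0 by omega)
        rw [mem_headVars] at ha
        have hal := lt_of_lt_of_le ha (hM.nbrCount_le_loopCount (not_lt.1 hjl))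
        refine ⟨a, ?_, (hM.pairExp_mem_iff a j).2 ha, fun _ => hal⟩
        have hne : a ≠ j := fun h => hjl (h ▸ hal)
        rw [hγ, Finsupp.add_apply, Finsupp.single_eq_of_ne hne, zero_add] at ha0
        exact ha0
    obtain ⟨a, β, rfl, haM, hal⟩ := hex
    rw [iterSum]
    refine Finset.add_mem_add (ih β ?_ fun k hk hkn => ?_) haM
    · rw [map_add, pairExp, map_add, Finsupp.degree_single, Finsupp.degree_single] at hα
      omega
    · have hk1 := h k hk hkn
      have hkl := hM.nbrCount_le_loopCount hk
      -- For `k ≤ j` the tail total drops by exactly one and the head total by at most one, since `a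
      -- < loopCount M ≤ k` and `j` lies outside the head. For `k > j` the tail is zero by
      -- maximality of `j`.
      rcases le_or_gt k j with hkj | hkj
      · have hal' := hal (hk.trans hkj)
        simp only [Finsupp.add_apply, Finset.sum_add_distrib] at hk1
        rw [sum_pairExp, sum_pairExp, if_neg (c := a ∈ tailVars n k), if_pos (c := j ∈ tailVars n k),
          if_neg (c := j ∈ headVars n _)] at hk1
        · split_ifs at hk1 <;> omega
        · rw [mem_headVars]; omega
        · exact mem_tailVars.2 hkj
        · rw [mem_tailVars]; omega
      · rw [Finset.sum_eq_zero]
        · exact Nat.zero_le _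
        · intro c hc
          have := hgt c (Fin.lt_def.2 (lt_of_lt_of_le hkj (mem_tailVars.1 hc)))
          rw [Finsupp.add_apply] at this
          omega

/-- Union bound over the conditions of `IsStronglyStable.mem_iterSum`, indexed from the last
variable by `j = n - 1 - k`, so that the tail has `k + 1` variables. -/
theorem IsStronglyStable.card_piAntidiag_le (hM : IsStronglyStable 2 M) (i : ℕ) :
    ((Finset.univ : Finset (Fin n)).piAntidiag (2 * i)).card ≤ (iterSum M i).card +
      ∑ k ∈ Finset.range (n - loopCount M),
        (exceeding (tailVars n (n - 1 - k)) (headVars n (nbrCount M (n - 1 - k))) (2 * i)).card := by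
  classical
  have hsub : (Finset.univ : Finset (Fin n)).piAntidiag (2 * i) ⊆
      Finset.image (fun α : Fin n →₀ ℕ => (⇑α : Fin n → ℕ)) (iterSum M i) ∪
        (Finset.range (n - loopCount M)).biUnion fun k =>
          exceeding (tailVars n (n - 1 - k)) (headVars n (nbrCount M (n - 1 - k))) (2 * i) := by
    intro α hα
    rw [Finset.mem_piAntidiag] at hα
    by_cases h : ∀ j, loopCount M ≤ j → j < n →
      ∑ c ∈ tailVars n j, α c ≤ ∑ c ∈ headVars n (nbrCount M j), α c
    · refine Finset.mem_union_left _ (Finset.mem_image.2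
        ⟨Finsupp.equivFunOnFinite.symm α, hM.mem_iterSum i _ ?_ h, rfl⟩)
      rw [Finsupp.degree_eq_sum]
      exact hα.1
    · push Not at h
      obtain ⟨j, hj, hjn, hlt⟩ := h
      refine Finset.mem_union_right _ (Finset.mem_biUnion.2 ⟨n - 1 - j, ?_, ?_⟩)
      · rw [Finset.mem_range]; omega
      · rw [show n - 1 - (n - 1 - j) = j by omega]
        exact mem_exceeding.2 ⟨hα.1, hlt⟩
  refine (Finset.card_le_card hsub).trans ((Finset.card_union_le _ _).trans ?_)
  exact Nat.add_le_add Finset.card_image_le Finset.card_biUnion_le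

theorem sum_range_succ_eq_choose_two (s : ℕ) :
    ∑ j ∈ Finset.range s, (j + 1) = (s + 1).choose 2 := by
  induction s with
  | zero => rfl
  | succ s ih =>
    rw [Finset.sum_range_succ, ih, Nat.choose_succ_succ' (s + 1) 1, Nat.choose_one_right, add_comm]

theorem choose_two_add (s p : ℕ) : (s + p).choose 2 = s.choose 2 + s * p + p.choose 2 := by
  induction p with
  | zero => simp
  | succ p ih =>
    rw [← add_assoc, Nat.choose_succ_succ' (s + p) 1, ih, Nat.choose_succ_succ' p 1,
      Nat.choose_one_right, Nat.choose_one_right]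
    ring

/-- The numerical constraints on the neighbour counts of a strongly stable set. -/
theorem IsStronglyStable.le_mul_nbrCount (hM : IsStronglyStable 2 M) {r p : ℕ}
    (hcard : M.card = n.choose 2 + r) (hp : n = loopCount M + p) {k : ℕ} (hk : k < p) :
    loopCount M * k + p.choose 2 + r ≤ (k + 1) * nbrCount M (n - 1 - k) := by
  have h1 := hM.card_le
  rw [hcard, show n.choose 2 = (loopCount M + p).choose 2 by rw [← hp],
    show Finset.range n = Finset.range (loopCount M + p) by rw [← hp],
    Finset.sum_range_add, choose_two_add] at h1
  -- Bound the columns below `loopCount M` by their full size, the last `k + 1` by the count at `n -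
  -- 1 - k` (by antitonicity), and the `q` others by `loopCount M`.
  have h2 : ∑ j ∈ Finset.range (loopCount M), min (nbrCount M j) (j + 1) ≤
      (loopCount M).choose 2 + loopCount M := by
    refine (Finset.sum_le_sum fun j _ => min_le_right _ _).trans ?_
    rw [sum_range_succ_eq_choose_two, Nat.choose_succ_succ' _ 1, Nat.choose_one_right, add_comm]
  have h3 : ∑ j ∈ Finset.range p,
      min (nbrCount M (loopCount M + j)) (loopCount M + j + 1) ≤
      ∑ j ∈ Finset.range p, nbrCount M (n - 1 - j) := by
    rw [← Finset.sum_range_reflect]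
    refine Finset.sum_le_sum fun j hj => (min_le_left _ _).trans (le_of_eq ?_)
    rw [Finset.mem_range] at hj
    congr 1
    omega
  obtain ⟨q, hq⟩ := Nat.exists_eq_add_of_le (Nat.succ_le_of_lt hk)
  have h4 : ∑ j ∈ Finset.range (k + 1), nbrCount M (n - 1 - j) ≤
      (k + 1) * nbrCount M (n - 1 - k) := by
    refine (Finset.sum_le_card_nsmul _ _ (nbrCount M (n - 1 - k)) fun j hj => ?_).trans (by simp)
    rw [Finset.mem_range] at hj
    exact hM.nbrCount_antitone (by omega)
  have h5 : ∑ j ∈ Finset.range q, nbrCount M (n - 1 - (k + 1 + j)) ≤ q * loopCount M := by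
    refine (Finset.sum_le_card_nsmul _ _ (loopCount M) fun j hj => ?_).trans (by simp)
    rw [Finset.mem_range] at hj
    exact hM.nbrCount_le_loopCount (by omega)
  have h6 : ∑ j ∈ Finset.range p, nbrCount M (n - 1 - j) =
      ∑ j ∈ Finset.range (k + 1), nbrCount M (n - 1 - j) +
        ∑ j ∈ Finset.range q, nbrCount M (n - 1 - (k + 1 + j)) := by
    rw [hq, Finset.sum_range_add]
  have h7 : loopCount M * p = loopCount M * k + loopCount M + q * loopCount M := by
    rw [hq, Nat.succ_eq_add_one]; ring
  omega

/-- The constraint at `k = p - 1`, whose neighbour count is itself at most `loopCount M`. -/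
theorem IsStronglyStable.add_choose_two_le_loopCount (hM : IsStronglyStable 2 M) {r p : ℕ}
    (hcard : M.card = n.choose 2 + r) (hp : n = loopCount M + p) (hp0 : 0 < p) :
    r + p.choose 2 ≤ loopCount M := by
  obtain ⟨k, rfl⟩ := Nat.exists_eq_succ_of_ne_zero hp0.ne'
  have h1 := hM.le_mul_nbrCount hcard hp (Nat.lt_succ_self k)
  have h2 := Nat.mul_le_mul_left (k + 1)
    (hM.nbrCount_le_loopCount (show loopCount M ≤ n - 1 - k by omega))
  have h3 : (k + 1) * loopCount M = loopCount M * k + loopCount M := by ring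
  omega

end StronglyStable

/-! ### The RevLex set and its powers -/

section RevLex

variable {n : ℕ}

theorem card_revLexGT {n : ℕ} (a b : Fin n) (hab : a ≤ b) [DecidablePred fun q : Fin n × Fin n =>
      q.1 ≤ q.2 ∧ RevLexGT q (a, b)] :
    (Finset.univ.filter fun q : Fin n × Fin n => q.1 ≤ q.2 ∧ RevLexGT q (a, b)).card =
      ((b : ℕ) + 1).choose 2 + a := by
  have hab' : (a : ℕ) ≤ b := hab
  have hb := b.2
  let h : ℕ → ℕ := fun y => if y < b then y + 1 else if y = b then a else 0
  have h0 : ∑ y ∈ Finset.range n, h y = ((b : ℕ) + 1).choose 2 + a := by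
    obtain ⟨q, hq⟩ := Nat.exists_eq_add_of_le (Nat.succ_le_of_lt b.2)
    rw [show Finset.range n = Finset.range ((b : ℕ).succ + q) by rw [← hq], Finset.sum_range_add,
      Nat.succ_eq_add_one, Finset.sum_range_succ,
      ← sum_range_succ_eq_choose_two]
    have h1 : ∑ y ∈ Finset.range (b : ℕ), h y = ∑ y ∈ Finset.range (b : ℕ), (y + 1) :=
      Finset.sum_congr rfl fun y hy => if_pos (Finset.mem_range.1 hy)
    have h2 : ∑ x ∈ Finset.range q, h (b + 1 + x) = 0 :=
      Finset.sum_eq_zero fun x _ => by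
        simp only [h]
        rw [if_neg (by omega), if_neg (by omega)]
    rw [h1, h2]
    simp [h]
  rw [← h0, ← card_filter_lt_fun]
  · congr 1
    ext ⟨x, y⟩
    simp only [RevLexGT, Finset.mem_filter, Finset.mem_univ, true_and, Fin.lt_def, Fin.le_def,
      Fin.ext_iff, h]
    split_ifs <;> omega
  · intro y hy
    simp only [h]
    split_ifs <;> omega

/-- The columns of larger index below `n - 1` contain `n.choose 2` pairs and come first; the last
column contributes its first `r` entries. -/
theorem mem_revLexPairs {r : ℕ} {a b : Fin n} :
    (a, b) ∈ revLexPairs n (n.choose 2 + r) ↔ a ≤ b ∧ ((b : ℕ) + 1 < n ∨ (a : ℕ) < r) := by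
  classical
  rw [revLexPairs, Finset.mem_filter]
  simp only [Finset.mem_univ, true_and]
  refine and_congr_right fun hab => ?_
  rw [card_revLexGT a b hab]
  have hab' : (a : ℕ) ≤ b := hab
  have hb := b.2
  by_cases hbn : (b : ℕ) + 1 < n
  · simp only [hbn, true_or, iff_true]
    have h1 : ((b : ℕ) + 2).choose 2 ≤ n.choose 2 := Nat.choose_le_choose 2 (by omega)
    have h2 : ((b : ℕ) + 2).choose 2 = (b + 1) + ((b : ℕ) + 1).choose 2 := by
      rw [Nat.choose_succ_succ' ((b : ℕ) + 1) 1, Nat.choose_one_right]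
    omega
  · rw [show (b : ℕ) + 1 = n by omega]
    omega

theorem card_revLexPairs {r : ℕ} (hr : r ≤ n) (hn : 0 < n) :
    (revLexPairs n (n.choose 2 + r)).card = n.choose 2 + r := by
  let h : ℕ → ℕ := fun y => if y + 1 < n then y + 1 else r
  have h0 : ∑ y ∈ Finset.range n, h y = n.choose 2 + r := by
    obtain ⟨m, rfl⟩ := Nat.exists_eq_succ_of_ne_zero hn.ne'
    rw [Nat.succ_eq_add_one, Finset.sum_range_succ, ← sum_range_succ_eq_choose_two]
    have h1 : ∑ y ∈ Finset.range m, h y = ∑ y ∈ Finset.range m, (y + 1) :=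
      Finset.sum_congr rfl fun y hy => if_pos (by have := Finset.mem_range.1 hy; omega)
    rw [h1]
    simp [h]
  refine Eq.trans ?_ ((card_filter_lt_fun (n := n) h ?_).trans h0)
  · congr 1
    · ext ⟨x, y⟩
      have hx := x.2
      have hy := y.2
      rw [mem_revLexPairs, Finset.mem_filter]
      simp only [Finset.mem_univ, true_and, Fin.le_def, h]
      split_ifs <;> omega
  · intro y hy
    simp only [h]
    split_ifs <;> omega

theorem eq_of_pairExp_eq {a b c d : Fin n} (hab : a ≤ b) (hcd : c ≤ d)
    (h : pairExp a b = pairExp c d) : a = c ∧ b = d := by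
  have e : ∀ x, pairExp a b x = pairExp c d x := fun x => by rw [h]
  have ea := e a
  have eb := e b
  have ec := e c
  simp only [pairExp, Finsupp.add_apply, Finsupp.single_apply, Fin.ext_iff] at ea eb ec
  simp only [Fin.ext_iff, Fin.le_def] at *
  split_ifs at ea eb ec <;> omega

theorem mem_revLex {r : ℕ} {m : Fin n →₀ ℕ} :
    m ∈ revLex n (n.choose 2 + r) ↔
      ∃ a b : Fin n, a ≤ b ∧ ((b : ℕ) + 1 < n ∨ (a : ℕ) < r) ∧ m = pairExp a b := by
  classical
  rw [revLex, Finset.mem_image]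
  constructor
  · rintro ⟨⟨a, b⟩, hp, rfl⟩
    rw [mem_revLexPairs] at hp
    exact ⟨a, b, hp.1, hp.2, rfl⟩
  · rintro ⟨a, b, hab, hp, rfl⟩
    exact ⟨(a, b), mem_revLexPairs.2 ⟨hab, hp⟩, rfl⟩

theorem card_revLex {r : ℕ} (hr : r ≤ n) (hn : 0 < n) :
    (revLex n (n.choose 2 + r)).card = n.choose 2 + r := by
  classical
  rw [revLex, Finset.card_image_of_injOn, card_revLexPairs hr hn]
  rintro ⟨a, b⟩ hab ⟨c, d⟩ hcd h
  rw [Finset.mem_coe, mem_revLexPairs] at hab hcd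
  obtain ⟨h1, h2⟩ := eq_of_pairExp_eq hab.1 hcd.1 h
  rw [h1, h2]

theorem pairExp_mem_revLex {r : ℕ} {a b : Fin n}
    (h : ((a : ℕ) + 1 < n ∧ (b : ℕ) + 1 < n) ∨ (a : ℕ) < r ∨ (b : ℕ) < r) :
    pairExp a b ∈ revLex n (n.choose 2 + r) := by
  rw [mem_revLex]
  rcases le_total a b with hab | hab
  · have : (a : ℕ) ≤ b := hab
    exact ⟨a, b, hab, by omega, rfl⟩
  · have : (b : ℕ) ≤ a := hab
    exact ⟨b, a, hab, by omega, pairExp_comm a b⟩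

theorem isStronglyStable_revLex {r : ℕ} :
    IsStronglyStable 2 (revLex n (n.choose 2 + r)) := by
  constructor
  · intro m hm
    obtain ⟨a, b, _, _, rfl⟩ := mem_revLex.1 hm
    simp [pairExp]
  · intro m hm i j hmi hji
    obtain ⟨a, b, hab, h, rfl⟩ := mem_revLex.1 hm
    have hab' : (a : ℕ) ≤ b := hab
    have hji' : (j : ℕ) < i := hji
    have hi : i = a ∨ i = b := by
      by_contra! hne
      simp [pairExp, hne.1, hne.2] at hmi
    rcases hi with rfl | rfl
    · rw [pairExp, add_tsub_cancel_left]
      exact pairExp_mem_revLex (by omega)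
    · rw [pairExp, add_tsub_cancel_right]
      exact pairExp_mem_revLex (by omega)

theorem tailVars_pred_eq_singleton (hn : 0 < n) :
    tailVars n (n - 1) = {⟨n - 1, Nat.sub_lt hn one_pos⟩} := by
  ext a
  have := a.2
  rw [mem_tailVars, Finset.mem_singleton, Fin.ext_iff]
  change n - 1 ≤ (a : ℕ) ↔ (a : ℕ) = n - 1
  omega

/-- Each generator divisible by the last variable carries a variable among the first `r`; the square
of the last variable, if present, forces that variable to be among them. -/
theorem sum_tailVars_le_of_mem_iterSum_revLex {r : ℕ} (i : ℕ) {α : Fin n →₀ ℕ}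
    (hα : α ∈ iterSum (revLex n (n.choose 2 + r)) i) :
    α.degree = 2 * i ∧ ∑ c ∈ tailVars n (n - 1), α c ≤ ∑ c ∈ headVars n r, α c := by
  induction i generalizing α with
  | zero =>
    have h0 : α = 0 := by simpa [iterSum] using hα
    simp [h0]
  | succ i ih =>
    rw [iterSum, Finset.mem_add] at hα
    obtain ⟨β, hβ, m, hm, rfl⟩ := hα
    obtain ⟨h1, h2⟩ := ih hβ
    have hd := isStronglyStable_revLex.1 m hm
    refine ⟨by rw [map_add, h1, hd]; ring, ?_⟩
    obtain ⟨a, b, hab, h, rfl⟩ := mem_revLex.1 hm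
    have hab' : (a : ℕ) ≤ b := hab
    simp only [Finsupp.add_apply, Finset.sum_add_distrib]
    refine add_le_add h2 ?_
    rw [sum_pairExp, sum_pairExp]
    simp only [mem_tailVars, mem_headVars]
    split_ifs <;> omega

theorem card_iterSum_revLex_add_le {r : ℕ} (i : ℕ) :
    (iterSum (revLex n (n.choose 2 + r)) i).card +
      (exceeding (tailVars n (n - 1)) (headVars n r) (2 * i)).card ≤
      ((Finset.univ : Finset (Fin n)).piAntidiag (2 * i)).card := by
  classical
  rw [← Finset.card_image_of_injective (iterSum (revLex n (n.choose 2 + r)) i)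
    (f := fun α : Fin n →₀ ℕ => (⇑α : Fin n → ℕ)) DFunLike.coe_injective,
    ← Finset.card_union_of_disjoint]
  · refine Finset.card_le_card (Finset.union_subset (fun α hα => ?_) (Finset.filter_subset _ _))
    obtain ⟨α, hαi, rfl⟩ := Finset.mem_image.1 hα
    have h := (sum_tailVars_le_of_mem_iterSum_revLex i hαi).1
    rw [Finsupp.degree_eq_sum] at h
    simpa [Finset.mem_piAntidiag] using h
  · refine Finset.disjoint_left.2 fun α hα hα' => ?_
    obtain ⟨α, hαi, rfl⟩ := Finset.mem_image.1 hα
    exact absurd (mem_exceeding.1 hα').2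
      (not_lt.2 (sum_tailVars_le_of_mem_iterSum_revLex i hαi).2)

/-! ### Asymptotic comparison of RevLex with other strongly stable sets -/

theorem exceeding_subset_of_subset_right {X Y Y' : Finset (Fin n)} (h : Y ⊆ Y') (d : ℕ) :
    exceeding X Y' d ⊆ exceeding X Y d := fun α hα => by
  rw [mem_exceeding] at hα ⊢
  exact ⟨hα.1, (Finset.sum_le_sum_of_subset h).trans_lt hα.2⟩

/-- Eventually, the RevLex set has the smallest sumsets among strongly stable sets. -/
theorem exists_forall_card_iterSum_revLex_le (n r : ℕ) (hr : r ≤ 50) (hn : r + 30 ≤ n) :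
    ∃ N : ℕ, ∀ i, N < i → ∀ M : Finset (Fin n →₀ ℕ), IsStronglyStable 2 M →
      M.card = n.choose 2 + r →
      (iterSum (revLex n (n.choose 2 + r)) i).card ≤ (iterSum M i).card := by
  have hn0 : 0 < n := by omega
  -- The upper bounds for `M` are taken in degree `2 * i + n`, the lower bound for RevLex in degree
  -- `2 * i - 1`; the gap is `n + 1`, and monomials of degree `d` number `(d + n - 1).choose (n -
  -- 1)`.
  obtain ⟨N, hN⟩ := exists_forall_three_mul_choose_le (n + 1) (n - 1)
  refine ⟨N, fun i hi M hM hcard => ?_⟩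
  have hup := card_iterSum_revLex_add_le (n := n) (r := r) i
  have hlow := hM.card_piAntidiag_le i
  suffices hs : ∑ k ∈ Finset.range (n - loopCount M),
      (exceeding (tailVars n (n - 1 - k)) (headVars n (nbrCount M (n - 1 - k))) (2 * i)).card ≤
      (exceeding (tailVars n (n - 1)) (headVars n r) (2 * i)).card by omega
  obtain ⟨p, hp⟩ := Nat.exists_eq_add_of_le (loopCount_le M)
  rw [show n - loopCount M = p by omega]
  rcases lt_trichotomy p 1 with h0 | rfl | h2
  · obtain rfl : p = 0 := by omega
    simp
  · rw [Finset.sum_range_one]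
    -- Only the last variable competes, and the constraint at `k = 0` gives it at least `r`
    -- neighbours.
    refine Finset.card_le_card (exceeding_subset_of_subset_right (fun a ha => ?_) _)
    have h := hM.le_mul_nbrCount hcard hp one_pos
    rw [mem_headVars] at ha ⊢
    simp only [mul_zero, zero_add, one_mul, Nat.sub_zero] at h ⊢
    omega
  · have hr' := hM.add_choose_two_le_loopCount hcard hp (by omega)
    have hB := sum_binomTail_le r p (loopCount M) (fun k => nbrCount M (n - 1 - k)) hr h2
      (by omega) hr' fun k hk => hM.le_mul_nbrCount hcard hp hk
    have hA : ((2 * i - 1 + (n - 1)).choose (n - 1) : ℝ) ≤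
        2 ^ r * ((exceeding (tailVars n (n - 1)) (headVars n r) (2 * i)).card : ℝ) := by
      have h := card_piAntidiag_le_two_pow_mul_card_exceeding
        (⟨n - 1, Nat.sub_lt hn0 one_pos⟩ : Fin n) (headVars n r)
        (by rw [mem_headVars]; change ¬ (n - 1 < r); omega) (2 * i - 1)
      rw [← tailVars_pred_eq_singleton hn0, card_headVars (by omega),
        show 2 * i - 1 + 1 = 2 * i by omega] at h
      have hc := card_piAntidiag_univ_fin_succ (n - 1) (2 * i - 1)
      rw [show n - 1 + 1 = n by omega] at hc
      rw [hc] at h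
      exact_mod_cast h
    have hC : (((Finset.univ : Finset (Fin n)).piAntidiag (2 * i + n)).card : ℝ) =
        ((2 * i - 1 + (n + 1) + (n - 1)).choose (n - 1) : ℝ) := by
      have hc := card_piAntidiag_univ_fin_succ (n - 1) (2 * i + n)
      rw [show n - 1 + 1 = n by omega] at hc
      rw [hc, show 2 * i - 1 + (n + 1) = 2 * i + n by omega]
    have hN' := hN (2 * i - 1) (by omega)
    rw [← hC] at hN'
    have hsum : (∑ k ∈ Finset.range p, ((exceeding (tailVars n (n - 1 - k))
        (headVars n (nbrCount M (n - 1 - k))) (2 * i)).card : ℝ)) ≤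
        (∑ k ∈ Finset.range p, binomTail (k + 1) (nbrCount M (n - 1 - k))) *
          ((Finset.univ : Finset (Fin n)).piAntidiag (2 * i + n)).card := by
      rw [Finset.sum_mul]
      refine Finset.sum_le_sum fun k hk => ?_
      rw [Finset.mem_range] at hk
      have hle := hM.nbrCount_le_loopCount (show loopCount M ≤ n - 1 - k by omega)
      have hdis : Disjoint (tailVars n (n - 1 - k)) (headVars n (nbrCount M (n - 1 - k))) := by
        refine Finset.disjoint_left.2 fun a ha ha' => ?_
        rw [mem_tailVars] at ha
        rw [mem_headVars] at ha'
        omega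
      have h := card_exceeding_le hn0 _ _ hdis (2 * i)
      rw [card_tailVars (by omega), card_headVars (by omega),
        show n - (n - 1 - k) = k + 1 by omega] at h
      refine h.trans (mul_le_mul_of_nonneg_left ?_ (binomTail_nonneg _ _))
      exact_mod_cast card_piAntidiag_mono hn0 (by omega)
    have hpos : (0 : ℝ) < 2 ^ r := by positivity
    have hfin : (∑ k ∈ Finset.range p, ((exceeding (tailVars n (n - 1 - k))
        (headVars n (nbrCount M (n - 1 - k))) (2 * i)).card : ℝ)) ≤
        ((exceeding (tailVars n (n - 1)) (headVars n r) (2 * i)).card : ℝ) := by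
      refine hsum.trans ((mul_le_mul_of_nonneg_right hB (Nat.cast_nonneg _)).trans ?_)
      rw [div_mul_eq_mul_div, div_le_iff₀ hpos, mul_comm _ ((2 : ℝ) ^ r)]
      exact hN'.trans hA
    exact_mod_cast hfin

theorem monomialForms_mem_formValues {𝕜 : Type*} [Field 𝕜] {d : ℕ} (M : Finset (Fin n →₀ ℕ))
    (hM : ∀ m ∈ M, m.degree = d) (i : ℕ) :
    hilbertFn 𝕜 (monomialForms 𝕜 M) i ∈ formValues 𝕜 n d M.card i := by
  classical
  have hcoe : ((M.image fun m => MvPolynomial.monomial m (1 : 𝕜) :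
      Finset (MvPolynomial (Fin n) 𝕜)) : Set (MvPolynomial (Fin n) 𝕜)) = monomialForms 𝕜 M := by
    rw [Finset.coe_image, monomialForms]
  refine ⟨M.image fun m => MvPolynomial.monomial m (1 : 𝕜), fun f hf => ?_, ?_,
    Finset.card_image_of_injective _ linearIndependent_monomials.injective, by rw [hcoe]⟩
  · obtain ⟨m, hm, rfl⟩ := Finset.mem_image.1 hf
    exact MvPolynomial.isHomogeneous_monomial _ (hM m hm)
  · rw [hcoe]
    exact (linearIndependent_monomials (𝕜 := 𝕜) (n := n)).linearIndepOn_id.mono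
      (Set.image_subset_range _ _)

end RevLex

end MinimalHF

theorem theorem3p14 (𝕜 : Type*) [Field 𝕜] (n r : ℕ) (hn : 80 ≤ n) (hr : 1 ≤ r) (hr' : r ≤ 50) :
    ∃ N : ℕ, ∀ i : ℕ, N < i →
      IsLeast (MinimalHF.stronglyStableValues 𝕜 n 2 (n.choose 2 + r) i)
        (MinimalHF.hilbertFn 𝕜
          (MinimalHF.monomialForms 𝕜 (MinimalHF.revLex n (n.choose 2 + r))) i) ∧
      IsLeast (MinimalHF.formValues 𝕜 n 2 (n.choose 2 + r) i)
        (MinimalHF.hilbertFn 𝕜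
          (MinimalHF.monomialForms 𝕜 (MinimalHF.revLex n (n.choose 2 + r))) i) := by
  obtain ⟨N, hN⟩ := MinimalHF.exists_forall_card_iterSum_revLex_le n r hr' (by omega)
  have hss := MinimalHF.isStronglyStable_revLex (n := n) (r := r)
  have hcard := MinimalHF.card_revLex (n := n) (r := r) (by omega) (by omega)
  refine ⟨N, fun i hi => ⟨⟨⟨_, hss, hcard, rfl⟩, ?_⟩, ⟨?_, ?_⟩⟩⟩
  · rintro _ ⟨M, hM, hMc, rfl⟩
    rw [MinimalHF.hilbertFn_monomialForms, MinimalHF.hilbertFn_monomialForms]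
    exact hN i hi M hM hMc
  · have h := MinimalHF.monomialForms_mem_formValues (𝕜 := 𝕜) _ hss.1 i
    rwa [hcard] at h
  · rintro _ ⟨W, hW, hli, hWc, rfl⟩
    obtain ⟨A, hA, hAc, hAi⟩ := MinimalHF.exists_monomials_card_iterSum_le 2 W hW hli
    obtain ⟨M, hM, hMc, hMi⟩ := MinimalHF.exists_stronglyStable_card_iterSum_le 2 A hA
    rw [MinimalHF.hilbertFn_monomialForms]
    exact (hN i hi M hM (by omega)).trans ((hMi i).trans (hAi i))
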